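/- Theorem 1. Setting. Let $n\ge 2$ nodes try to learn a vector $\mu\in\mathbb R^l$. At each time $t=0,1,2,\dots$ a (deterministic) undirected graph $G(t)$ without self-loops on the nodes $\{1,\dots,n\}$ is given, together with the set $S(t)$ of nodes that have a measurement at time $t$; $N_i(t)$ is the set of neighbors of $i$ in $G(t)$ and $d_i(t)=|N_i(t)|$. The times $t$ with $S(t)\neq\emptyset$ form an increasing sequence $t_1<t_2<\cdots$ with $t_1=1$ and $t_{k+1}-t_k<T$ for all $k\ge 1$, where $T$ is a positive integer. The node estimates $v_i(t)\in\mathbb R^l$ are updated by $$v_i(t+1)=v_i(t)+\mathbf 1_{\{i\in S(t)\}}\frac{\Delta(t)}4\bigl(\mu+w_i(t)-v_i(t)\bigr)+\frac{\Delta(t)}4\sum_{j\in N_i(t)}\frac{v_j(t)-v_i(t)+w_{ij}(t)}{\max(d_i(t),d_j(t))},\qquad \Delta(t)=\frac1{(t+1)^{1-\epsilon}},$$ with $\epsilon\in(0,1)$. All the random vectors $w_i(t)$, $w_{ij}(t)$ are independent of each other and of the (square-integrable, possibly deterministic) initial estimates $v(0)$; every entry of $w_i(t)$ has mean $0$ and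 variance $\sigma^2$, and every entry of $w_{ij}(t)$ has mean $0$ and variance $(\sigma')^2$. Put $v(t)=(v_1(t),\dots,v_n(t))$ and $Z(t)=\sum_{i=1}^n\|v_i(t)-\mu\|_2^2$; then $Z(t)$ is integrable for every $t$. Let $M=\max_t|S(t)|$ and $d_{\max}=\max_{t,i}d_i(t)$. (1) Suppose that every $G(t)$ is connected, and let $\mathcal H$ be the largest expected hitting time, from any node to any node and on any of the graphs $G(t)$, of the lazy Metropolis walk (which moves from $i$ to a neighbor $j$ with probability $1/(4\max(d_i(t),d_j(t)))$ and otherwise stays at $i$). Then $\mathcal H$ is finite, and for every integer $$t\ \ge\ 2T\left[\frac{288\,T\mathcal H}{\epsilon}\ln\left(\frac{96\,T\mathcal H}{\epsilon}\right)\right]^{1/\epsilon}$$ we have, almost surely, $$E[Z(t)\mid v(1)]\ \le\ 15\,\mathcal H\,T\,l\,\frac{M\sigma^2+nT(\sigma')^2}{(t/T-1)^{1-\epsilon}}+Z(1)\,\exp\left(-\frac{(t/T-1)^{\epsilon}-2}{24\,\mathcal H\,T\,\epsilon}\right).$$ (2) Suppose instead only that $(G(t))$ is $B$-connected for a positive integer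 $B$, that is, for every integer $k\ge0$ the union of the graphs $G(kB+1),\dots,G((k+1)B)$ is connected. Put $K=\max(T,B)$. Then for every integer $$t\ \ge\ 2K\left[\frac{384\,n^2d_{\max}(1+K)}{\epsilon}\ln\left(\frac{128\,n^2d_{\max}(1+K)}{\epsilon}\right)\right]^{1/\epsilon}$$ we have, almost surely, $$E[Z(t)\mid v(1)]\ \le\ 2n^2d_{\max}K\,l\,\frac{M\sigma^2+2n(1+K)(\sigma')^2}{(t/K)^{1-\epsilon}}+Z(1)\,\exp\left(-\frac{(t/K)^{\epsilon}-2}{32\,n^2d_{\max}(1+K)\,\epsilon}\right).$$ -/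

import Mathlib

open MeasureTheory ProbabilityTheory

namespace CoopLearning

noncomputable section

section Graphs

variable {n : ℕ}

open Classical in
/-- `max(d(i), d(j))`, the larger of the degrees of `i` and `j` in `G`. -/
def maxDeg (G : SimpleGraph (Fin n)) (i j : Fin n) : ℝ :=
  max (G.degree i : ℝ) (G.degree j : ℝ)

open Classical in
/-- Off-diagonal transition probabilities of the lazy Metropolis walk. -/
def moveProb (G : SimpleGraph (Fin n)) (i j : Fin n) : ℝ :=
  if G.Adj i j then 1 / (4 * maxDeg G i j) else 0

/-- Transition matrix of the lazy Metropolis walk on `G`: from `i` the walk moves to a neighbour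
`j` with probability `1 / (4 max(d(i), d(j)))` and otherwise stays at `i`. -/
def lazyMetropolis (G : SimpleGraph (Fin n)) (i j : Fin n) : ℝ :=
  if i = j then 1 - ∑ k, moveProb G i k else moveProb G i j

open Classical in
/-- Probability that the lazy Metropolis walk started at `i` does not visit `j` at any of the times
`0, 1, …, k`: the total probability of the trajectories `x 0 = i, x 1, …, x k` that avoid `j`. -/
def avoidProb (G : SimpleGraph (Fin n)) (i j : Fin n) (k : ℕ) : ℝ :=
  ∑ x : Fin (k + 1) → Fin n with x 0 = i ∧ ∀ s, x s ≠ j,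
    ∏ s : Fin k, lazyMetropolis G (x s.castSucc) (x s.succ)

/-- Expected time `E[τ] = ∑ₖ P(τ > k)` until the lazy Metropolis walk started at `i`
visits `j` (possibly infinite). -/
def hittingTime (G : SimpleGraph (Fin n)) (i j : Fin n) : ENNReal :=
  ∑' k : ℕ, ENNReal.ofReal (avoidProb G i j k)

/-- The largest hitting time from any node to any node in any of the graphs `G t`. -/
def maxHittingTime (G : ℕ → SimpleGraph (Fin n)) : ENNReal :=
  ⨆ (t : ℕ) (i : Fin n) (j : Fin n), hittingTime (G t) i j

open Classical in
/-- The largest degree of any node in the sequence `G t` (the supremum is over a set of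
natural numbers bounded by `n`, so it is a maximum). -/
def dMax (G : ℕ → SimpleGraph (Fin n)) : ℕ :=
  ⨆ p : ℕ × Fin n, (G p.1).degree p.2

/-- The largest number of nodes that have a measurement at any one time (a maximum over
natural numbers bounded by `n`). -/
def maxMeasuring (S : ℕ → Finset (Fin n)) : ℕ :=
  ⨆ t : ℕ, (S t).card

/-- For every `k`, the union of the graphs at times `kB + 1, …, (k + 1)B` is connected. -/
def BConnected (B : ℕ) (G : ℕ → SimpleGraph (Fin n)) : Prop :=
  0 < B ∧ ∀ k : ℕ, (⨆ t ∈ Finset.Icc (k * B + 1) ((k + 1) * B), G t).Connected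

/-- `S t` is the set of nodes that have a measurement at time `t`. The measurement times
(those `t` with `S t` nonempty) form an increasing sequence `τ 0 < τ 1 < …` that starts at
time `1` and has gaps smaller than `T`. -/
def UniformMeasurement (T : ℕ) (S : ℕ → Finset (Fin n)) : Prop :=
  ∃ τ : ℕ → ℕ, StrictMono τ ∧ Set.range τ = {t | (S t).Nonempty} ∧ τ 0 = 1 ∧
    ∀ k, τ (k + 1) - τ k < T

end Graphs

section Protocol

variable {n l : ℕ} {Ω : Type*}

/-- The stepsize `Δ(t) = 1 / (t + 1) ^ (1 - ε)`. -/
def stepsize (ε : ℝ) (t : ℕ) : ℝ := 1 / ((t : ℝ) + 1) ^ (1 - ε)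

open Classical in
/-- The estimates `v_i(t)` generated by the protocol. Node `i` sees the noisy offsets
`v_j(t) - v_i(t) + w_ij(t)` of its neighbours and, if `i ∈ S t`, the noisy measurement
`μ + w_i(t)`. Here `wm i t` is `w_i(t)` and `wc i j t` is `w_ij(t)`. -/
def estimate (Δ : ℕ → ℝ) (G : ℕ → SimpleGraph (Fin n)) (S : ℕ → Finset (Fin n))
    (μ : EuclideanSpace ℝ (Fin l))
    (wm : Fin n → ℕ → Ω → EuclideanSpace ℝ (Fin l))
    (wc : Fin n → Fin n → ℕ → Ω → EuclideanSpace ℝ (Fin l))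
    (v₀ : Ω → Fin n → EuclideanSpace ℝ (Fin l)) :
    ℕ → Ω → Fin n → EuclideanSpace ℝ (Fin l)
  | 0 => v₀
  | t + 1 => fun ω i =>
      let v := estimate Δ G S μ wm wc v₀ t ω
      v i + (if i ∈ S t then (Δ t / 4) • ((μ + wm i t ω) - v i) else 0)
        + (Δ t / 4) • ∑ j ∈ (G t).neighborFinset i,
            (1 / maxDeg (G t) i j) • (v j - v i + wc i j t ω)

/-- The variance `Z = ∑ᵢ ‖v_i - μ‖²`. -/
def variance (μ : EuclideanSpace ℝ (Fin l)) (v : Fin n → EuclideanSpace ℝ (Fin l)) : ℝ :=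
  ∑ i, ‖v i - μ‖ ^ 2

/-- All measurement noises and all communication noises as a single family. -/
def noiseFamily (wm : Fin n → ℕ → Ω → EuclideanSpace ℝ (Fin l))
    (wc : Fin n → Fin n → ℕ → Ω → EuclideanSpace ℝ (Fin l)) :
    (Fin n × ℕ) ⊕ (Fin n × Fin n × ℕ) → Ω → EuclideanSpace ℝ (Fin l) :=
  Sum.elim (fun p => wm p.1 p.2) (fun p => wc p.1 p.2.1 p.2.2)

/-- Every entry of the random vector `w` has mean zero and (finite) variance `s ^ 2`. -/
def CenteredWithVariance [MeasurableSpace Ω] (P : Measure Ω) (s : ℝ)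
    (w : Ω → EuclideanSpace ℝ (Fin l)) : Prop :=
  ∀ a : Fin l, MemLp (fun ω => w ω a) 2 P ∧ ∫ ω, w ω a ∂P = 0 ∧
    ProbabilityTheory.variance (fun ω => w ω a) P = s ^ 2

/-- The probabilistic assumptions: the noise vectors are independent of each other and of the
initial estimates; the measurement noises have entrywise mean zero and variance `σ ^ 2`, the
communication noises entrywise mean zero and variance `σ' ^ 2`. The moments are prescribed only
for the noises that the protocol uses. -/
structure NoiseModel [MeasurableSpace Ω] (P : Measure Ω)
    (G : ℕ → SimpleGraph (Fin n)) (S : ℕ → Finset (Fin n)) (σ σ' : ℝ)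
    (wm : Fin n → ℕ → Ω → EuclideanSpace ℝ (Fin l))
    (wc : Fin n → Fin n → ℕ → Ω → EuclideanSpace ℝ (Fin l))
    (v₀ : Ω → Fin n → EuclideanSpace ℝ (Fin l)) : Prop where
  measurable_wm : ∀ i t, Measurable (wm i t)
  measurable_wc : ∀ i j t, Measurable (wc i j t)
  measurable_init : Measurable v₀
  memLp_init : ∀ i, MemLp (fun ω => v₀ ω i) 2 P
  moments_wm : ∀ t, ∀ i ∈ S t, CenteredWithVariance P σ (wm i t)
  moments_wc : ∀ t i j, (G t).Adj i j → CenteredWithVariance P σ' (wc i j t)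
  indep_noise : iIndepFun (noiseFamily wm wc) P
  indep_init : IndepFun v₀ (fun ω p => noiseFamily wm wc p ω) P

end Protocol

end

end CoopLearning

/-! Fix a coordinate. The errors `x i = v i - μ` evolve by `x(t+1) = A(t) x(t) + (Δ(t)/4) · noise`,
where `A(t) = I - (Δ(t)/4)(1_S + Lap)` and `Lap` is the Laplacian of the Metropolis weights (`step`,
`estimate_succ_sub`). Unroll this from time 1. The noises of times `≥ 1` are centered, pairwise
independent and independent of `v(1)`, so the conditional mean of the squared error is exactly the
square of the noiseless evolution plus a deterministic sum of squared impulse responses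
(`NoiseModel.condExp_variance`). Entries of one noise vector may be dependent, since `Z` adds
squares coordinate by coordinate. Everything reduces to norms of products of the `A(s)`.

One step lowers `|x|²` by at least `Δ/4` times the energy `∑_S x_i² + ½ ∑∑ w_ij (x_i - x_j)²`
(`sqNorm_step_le`), so contraction follows from a Poincaré inequality `|x|² ≤ C · energy`. For a
connected graph with a measurement at `j`, the hitting time `h` of `j` solves `Lap h = 4` off `j`,
and a Hardy-type inequality with weight `4/h` gives `C = H` (`four_mul_sum_div_le`,
`sqNorm_le_hitting_mul_energy`). For jointly connected graphs, every gap between consecutive sorted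
initial values is, at some time of the window, bridged by an edge or pulled down by a measurement;
hence the energies summed along the window dominate `|x|²/(n² d)` (`exists_crossing`,
`sqNorm_le_sum_energy`). The latter bound, for a single graph, also yields geometric decay of
avoidance probabilities, hence finite hitting times.

So a window of length `L` contracts `|x|²` by `1 - κ Δ(end)`, with `κ = 1/(4H)` or `1/(4 n² d)`. The
product over windows gives the exponential term. In the noise sum (`noise_bound`), the first half of
the windows is negligible because many contractions follow; in the second half the stepsizes are
comparable with `t^(ε-1)`, and a geometric series of ratio `1 - κ t^(ε-1)` gives order `(K/κ)
u^(ε-1)` with `u = t/K` (`K = T` in the first part). The threshold on `t` makes `u^ε` dominate `log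
u`, which justifies discarding the first half (`log_le_rpow_of_threshold`). -/

namespace CoopLearning

noncomputable section

/-! ### Metropolis weights, the noiseless step and its energy decrease. -/

section Operators

variable {n : ℕ}

open Classical in
/-- Metropolis weight of the pair `i`, `j`. -/
def weight (G : SimpleGraph (Fin n)) (i j : Fin n) : ℝ :=
  if G.Adj i j then 1 / maxDeg G i j else 0

theorem maxDeg_comm (G : SimpleGraph (Fin n)) (i j : Fin n) : maxDeg G i j = maxDeg G j i :=
  max_comm _ _

theorem weight_comm (G : SimpleGraph (Fin n)) (i j : Fin n) : weight G i j = weight G j i := by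
  by_cases h : G.Adj i j
  · simp [weight, h, h.symm, maxDeg_comm G i j]
  · simp [weight, h, mt SimpleGraph.Adj.symm h]

theorem maxDeg_nonneg (G : SimpleGraph (Fin n)) (i j : Fin n) : 0 ≤ maxDeg G i j :=
  le_max_of_le_left (Nat.cast_nonneg _)

theorem one_le_maxDeg {G : SimpleGraph (Fin n)} {i j : Fin n} (h : G.Adj i j) :
    1 ≤ maxDeg G i j := by
  classical
  refine le_max_of_le_left ?_
  have : 0 < G.degree i := (G.degree_pos_iff_exists_adj i).2 ⟨j, h⟩
  exact_mod_cast this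

theorem weight_nonneg (G : SimpleGraph (Fin n)) (i j : Fin n) : 0 ≤ weight G i j := by
  unfold weight
  split_ifs
  · exact one_div_nonneg.2 (maxDeg_nonneg G i j)
  · exact le_rfl

theorem weight_le_one (G : SimpleGraph (Fin n)) (i j : Fin n) : weight G i j ≤ 1 := by
  unfold weight
  split_ifs with h
  · exact (div_le_one (zero_lt_one.trans_le (one_le_maxDeg h))).2 (one_le_maxDeg h)
  · exact zero_le_one

theorem weight_self (G : SimpleGraph (Fin n)) (i : Fin n) : weight G i i = 0 := by
  simp [weight]

theorem weight_eq_zero {G : SimpleGraph (Fin n)} {i j : Fin n} (h : ¬ G.Adj i j) :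
    weight G i j = 0 := by
  simp [weight, h]

theorem moveProb_eq (G : SimpleGraph (Fin n)) (i j : Fin n) :
    moveProb G i j = weight G i j / 4 := by
  unfold moveProb weight
  split_ifs
  · rw [div_div, mul_comm]
  · simp

open Classical in
theorem degree_le_maxDeg (G : SimpleGraph (Fin n)) (i j : Fin n) :
    (G.degree i : ℝ) ≤ maxDeg G i j := by
  unfold maxDeg
  refine le_trans (le_of_eq ?_) (le_max_left _ _)
  congr!

open Classical in
theorem sum_weight_mul (G : SimpleGraph (Fin n)) (i : Fin n) (f : Fin n → ℝ) :
    ∑ j, weight G i j * f j = ∑ j ∈ G.neighborFinset i, 1 / maxDeg G i j * f j := by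
  rw [SimpleGraph.neighborFinset_eq_filter, Finset.sum_filter]
  refine Finset.sum_congr rfl fun j _ => ?_
  unfold weight
  split_ifs <;> simp

theorem sum_weight_le_one (G : SimpleGraph (Fin n)) (i : Fin n) : ∑ j, weight G i j ≤ 1 := by
  classical
  have h := sum_weight_mul G i fun _ => 1
  simp only [mul_one] at h
  rw [h]
  rcases Nat.eq_zero_or_pos (G.degree i) with h0 | h0
  · have : G.neighborFinset i = ∅ := by
      rw [← Finset.card_eq_zero]; simpa using h0
    simp [this]
  · have hd : (0 : ℝ) < G.degree i := by exact_mod_cast h0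
    calc ∑ j ∈ G.neighborFinset i, 1 / maxDeg G i j
        ≤ ∑ j ∈ G.neighborFinset i, 1 / (G.degree i : ℝ) := by
          refine Finset.sum_le_sum fun j _ => one_div_le_one_div_of_le hd ?_
          convert degree_le_maxDeg G i j
      _ = 1 := by
          rw [Finset.sum_const, SimpleGraph.card_neighborFinset_eq_degree, nsmul_eq_mul]
          field_simp

/-- Squared Euclidean norm of a real tuple. -/
def sqNorm (x : Fin n → ℝ) : ℝ := ∑ i, x i ^ 2

theorem sqNorm_nonneg (x : Fin n → ℝ) : 0 ≤ sqNorm x :=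
  Finset.sum_nonneg fun _ _ => sq_nonneg _

/-- The noiseless update of the estimation errors in one coordinate. -/
def step (δ : ℝ) (G : SimpleGraph (Fin n)) (S : Finset (Fin n)) :
    (Fin n → ℝ) →ₗ[ℝ] (Fin n → ℝ) where
  toFun x i := x i - δ / 4 * ((if i ∈ S then x i else 0) + ∑ j, weight G i j * (x i - x j))
  map_add' x y := by
    funext i
    have : ∑ j, weight G i j * (x i + y i - (x j + y j))
        = ∑ j, weight G i j * (x i - x j) + ∑ j, weight G i j * (y i - y j) := by
      rw [← Finset.sum_add_distrib]
      exact Finset.sum_congr rfl fun j _ => by ring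
    simp only [Pi.add_apply, this]
    split_ifs <;> ring
  map_smul' c x := by
    funext i
    have : ∑ j, weight G i j * (c * x i - c * x j) = c * ∑ j, weight G i j * (x i - x j) := by
      rw [Finset.mul_sum]
      exact Finset.sum_congr rfl fun j _ => by ring
    simp only [Pi.smul_apply, smul_eq_mul, this, RingHom.id_apply]
    split_ifs <;> ring

theorem step_apply (δ : ℝ) (G : SimpleGraph (Fin n)) (S : Finset (Fin n)) (x : Fin n → ℝ)
    (i : Fin n) : step δ G S x i =
      x i - δ / 4 * ((if i ∈ S then x i else 0) + ∑ j, weight G i j * (x i - x j)) := rfl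

/-- The quadratic form governing the decay of the squared error. -/
def energy (G : SimpleGraph (Fin n)) (S : Finset (Fin n)) (x : Fin n → ℝ) : ℝ :=
  ∑ i ∈ S, x i ^ 2 + (∑ i, ∑ j, weight G i j * (x i - x j) ^ 2) / 2

theorem energy_nonneg (G : SimpleGraph (Fin n)) (S : Finset (Fin n)) (x : Fin n → ℝ) :
    0 ≤ energy G S x := by
  unfold energy
  refine add_nonneg (Finset.sum_nonneg fun _ _ => sq_nonneg _) (div_nonneg ?_ zero_le_two)
  exact Finset.sum_nonneg fun i _ => Finset.sum_nonneg fun j _ =>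
    mul_nonneg (weight_nonneg G i j) (sq_nonneg _)

/-- Summation by parts for the Metropolis weights. -/
theorem sum_mul_laplacian (G : SimpleGraph (Fin n)) (x y : Fin n → ℝ) :
    ∑ i, y i * ∑ j, weight G i j * (x i - x j)
      = (∑ i, ∑ j, weight G i j * ((y i - y j) * (x i - x j))) / 2 := by
  have h1 : ∑ i, y i * ∑ j, weight G i j * (x i - x j)
      = ∑ i, ∑ j, weight G i j * (y i * (x i - x j)) := by
    refine Finset.sum_congr rfl fun i _ => ?_
    rw [Finset.mul_sum]
    exact Finset.sum_congr rfl fun j _ => by ring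
  have h2 : ∑ i, ∑ j, weight G i j * (y i * (x i - x j))
      = ∑ i, ∑ j, weight G i j * (-(y j * (x i - x j))) := by
    rw [Finset.sum_comm]
    refine Finset.sum_congr rfl fun i _ => Finset.sum_congr rfl fun j _ => ?_
    rw [weight_comm G j i]; ring
  rw [h1, eq_div_iff two_ne_zero, mul_two]
  nth_rewrite 2 [h2]
  rw [← Finset.sum_add_distrib]
  refine Finset.sum_congr rfl fun i _ => ?_
  rw [← Finset.sum_add_distrib]
  exact Finset.sum_congr rfl fun j _ => by ring

theorem sq_sum_weight_mul_le (G : SimpleGraph (Fin n)) (i : Fin n) (f : Fin n → ℝ) :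
    (∑ j, weight G i j * f j) ^ 2 ≤ ∑ j, weight G i j * f j ^ 2 := by
  have h := Finset.sum_sq_le_sum_mul_sum_of_sq_le_mul Finset.univ
    (r := fun j => weight G i j * f j) (f := fun j => weight G i j)
    (g := fun j => weight G i j * f j ^ 2) (fun j _ => weight_nonneg G i j)
    (fun j _ => mul_nonneg (weight_nonneg G i j) (sq_nonneg _)) (fun j _ => le_of_eq (by ring))
  refine h.trans (mul_le_of_le_one_left ?_ (sum_weight_le_one G i))
  exact Finset.sum_nonneg fun j _ => mul_nonneg (weight_nonneg G i j) (sq_nonneg _)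

/-- One noiseless step decreases the squared norm by a multiple of the energy. -/
theorem sqNorm_step_le {δ : ℝ} (h0 : 0 ≤ δ) (h1 : δ ≤ 1) (G : SimpleGraph (Fin n))
    (S : Finset (Fin n)) (x : Fin n → ℝ) :
    sqNorm (step δ G S x) ≤ sqNorm x - δ / 4 * energy G S x := by
  set a : Fin n → ℝ := fun i => if i ∈ S then x i else 0 with ha
  set b : Fin n → ℝ := fun i => ∑ j, weight G i j * (x i - x j) with hb
  have haS : ∑ i, a i ^ 2 = ∑ i ∈ S, x i ^ 2 := by
    simp [ha, ite_pow, Finset.sum_ite_mem]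
  have hax : ∑ i, x i * a i = ∑ i ∈ S, x i ^ 2 := by
    simp [ha, mul_ite, Finset.sum_ite_mem, pow_two]
  have hbx : ∑ i, x i * b i = (∑ i, ∑ j, weight G i j * (x i - x j) ^ 2) / 2 := by
    rw [hb, sum_mul_laplacian G x x]
    simp only [pow_two]
  have hbb : ∑ i, b i ^ 2 ≤ ∑ i, ∑ j, weight G i j * (x i - x j) ^ 2 :=
    Finset.sum_le_sum fun i _ => sq_sum_weight_mul_le G i fun j => x i - x j
  have hE : energy G S x = ∑ i, x i * a i + ∑ i, x i * b i := by
    rw [hax, hbx]; rfl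
  have hE0 := energy_nonneg G S x
  have hab : ∑ i, (a i + b i) ^ 2 ≤ 4 * energy G S x := by
    have : ∑ i, (a i + b i) ^ 2 ≤ ∑ i, (2 * a i ^ 2 + 2 * b i ^ 2) :=
      Finset.sum_le_sum fun i _ => by nlinarith [sq_nonneg (a i - b i)]
    rw [Finset.sum_add_distrib, ← Finset.mul_sum, ← Finset.mul_sum] at this
    have h2 : 0 ≤ ∑ i, a i ^ 2 := Finset.sum_nonneg fun _ _ => sq_nonneg _
    rw [hE, hax, hbx]
    linarith
  have key : sqNorm (step δ G S x)
      = sqNorm x - δ / 2 * energy G S x + δ ^ 2 / 16 * ∑ i, (a i + b i) ^ 2 := by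
    rw [hE]
    unfold sqNorm
    simp only [step_apply]
    rw [← Finset.sum_add_distrib, Finset.mul_sum, Finset.mul_sum, ← Finset.sum_sub_distrib,
      ← Finset.sum_add_distrib]
    exact Finset.sum_congr rfl fun i _ => by
      change (x i - δ / 4 * (a i + b i)) ^ 2 = _
      ring
  rw [key]
  -- The first-order decrease is `δ/2` times the energy; since `δ² ≤ δ`, the second-order term costs
  -- at most half of it.
  have h3 : δ ^ 2 / 16 * ∑ i, (a i + b i) ^ 2 ≤ δ / 16 * (4 * energy G S x) := by
    refine mul_le_mul ?_ hab (Finset.sum_nonneg fun _ _ => sq_nonneg _) (by positivity)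
    nlinarith
  linarith

theorem sqNorm_step_le_sqNorm {δ : ℝ} (h0 : 0 ≤ δ) (h1 : δ ≤ 1) (G : SimpleGraph (Fin n))
    (S : Finset (Fin n)) (x : Fin n → ℝ) : sqNorm (step δ G S x) ≤ sqNorm x := by
  have := sqNorm_step_le h0 h1 G S x
  have := mul_nonneg (div_nonneg h0 zero_le_four) (energy_nonneg G S x)
  linarith

/-- Composition of the operators `A s, …, A (s + k - 1)`. -/
def propagate (A : ℕ → (Fin n → ℝ) →ₗ[ℝ] (Fin n → ℝ)) (s : ℕ) :
    ℕ → (Fin n → ℝ) →ₗ[ℝ] (Fin n → ℝ)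
  | 0 => LinearMap.id
  | k + 1 => A (s + k) ∘ₗ propagate A s k

theorem propagate_add (A : ℕ → (Fin n → ℝ) →ₗ[ℝ] (Fin n → ℝ)) (s j k : ℕ) (x : Fin n → ℝ) :
    propagate A s (j + k) x = propagate A (s + j) k (propagate A s j x) := by
  induction k with
  | zero => rfl
  | succ k ih =>
    change A (s + (j + k)) (propagate A s (j + k) x) = _
    rw [ih, ← add_assoc]
    rfl

end Operators

/-! ### Energy lower bound on windows of jointly connected graphs. -/

section Crossing

variable {n : ℕ}

/-- A connected union of graphs has an edge across every nontrivial cut. -/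
theorem exists_adj_of_connected_iSup {L : ℕ} {G : ℕ → SimpleGraph (Fin n)}
    (h : (⨆ s ∈ Finset.range L, G s).Connected) (U : Set (Fin n)) {a b : Fin n}
    (ha : a ∈ U) (hb : b ∉ U) : ∃ s < L, ∃ i ∈ U, ∃ j, j ∉ U ∧ (G s).Adj i j := by
  obtain ⟨p⟩ := h.preconnected a b
  obtain ⟨e, -, h1, h2⟩ := p.exists_boundary_dart U ha hb
  have := e.adj
  simp only [SimpleGraph.iSup_adj, Finset.mem_range] at this
  obtain ⟨s, hs, hadj⟩ := this
  exact ⟨s, hs, _, h1, _, h2, hadj⟩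

/-- Discrete minimum principle: row sums are at most one, so without a measurement the new value is
a convex combination of old values of `i` and its neighbours. -/
theorem le_step_apply {δ : ℝ} (h0 : 0 ≤ δ) (h1 : δ ≤ 1) {G : SimpleGraph (Fin n)}
    {S : Finset (Fin n)} {x : Fin n → ℝ} {i : Fin n} {c : ℝ} (hi : c ≤ x i) (hS : i ∉ S)
    (hN : ∀ j, G.Adj i j → c ≤ x j) : c ≤ step δ G S x i := by
  have hsum : ∑ j, weight G i j * (x i - x j) ≤ x i - c := by
    calc ∑ j, weight G i j * (x i - x j) ≤ ∑ j, weight G i j * (x i - c) := by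
          refine Finset.sum_le_sum fun j _ => ?_
          by_cases h : G.Adj i j
          · exact mul_le_mul_of_nonneg_left (by linarith [hN j h]) (weight_nonneg G i j)
          · simp [weight_eq_zero h]
      _ ≤ x i - c := by
          rw [← Finset.sum_mul]
          exact mul_le_of_le_one_left (by linarith) (sum_weight_le_one G i)
  rw [step_apply, if_neg hS]
  nlinarith

/-- Companion upper bound. A measurement pulls the value towards `0`, which does no harm because `0
≤ c`. -/
theorem step_apply_le {δ : ℝ} (h0 : 0 ≤ δ) (h1 : δ ≤ 1) {G : SimpleGraph (Fin n)}
    {S : Finset (Fin n)} {x : Fin n → ℝ} {i : Fin n} {c : ℝ} (hc : 0 ≤ c) (hi : x i ≤ c)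
    (hN : ∀ j, G.Adj i j → x j ≤ c) : step δ G S x i ≤ c := by
  have hsum : x i - c ≤ ∑ j, weight G i j * (x i - x j) := by
    calc x i - c ≤ ∑ j, weight G i j * (x i - c) := by
          rw [← Finset.sum_mul]
          nlinarith [sum_weight_le_one G i]
      _ ≤ ∑ j, weight G i j * (x i - x j) := by
          refine Finset.sum_le_sum fun j _ => ?_
          by_cases h : G.Adj i j
          · exact mul_le_mul_of_nonneg_left (by linarith [hN j h]) (weight_nonneg G i j)
          · simp [weight_eq_zero h]
  have hm : x i - c ≤ if i ∈ S then x i else 0 := by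
    split_ifs <;> linarith
  rw [step_apply]
  nlinarith

/-- If a measurement is made and the graphs are jointly connected, then a gap of the initial
values is crossed by an edge or pulled down by a measurement. -/
theorem exists_crossing {L : ℕ} {δ : ℕ → ℝ} (hδ0 : ∀ s, 0 ≤ δ s) (hδ1 : ∀ s, δ s ≤ 1)
    {G : ℕ → SimpleGraph (Fin n)} {S : ℕ → Finset (Fin n)} {x : ℕ → Fin n → ℝ}
    (hx : ∀ s < L, x (s + 1) = step (δ s) (G s) (S s) (x s))
    (hG : (⨆ s ∈ Finset.range L, G s).Connected) (hS : ∃ s < L, (S s).Nonempty)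
    {lo hi : ℝ} (hlo : 0 ≤ lo) (hsep : ∀ i, x 0 i ≤ lo ∨ hi ≤ x 0 i)
    (htop : ∃ i, hi ≤ x 0 i) :
    ∃ s < L, (∃ i j, (G s).Adj i j ∧ hi ≤ x s i ∧ x s j ≤ lo) ∨ ∃ i ∈ S s, hi ≤ x s i := by
  by_contra! H
  -- As long as no crossing occurs, high nodes have only high neighbours and no measurement, while
  -- low nodes have only low neighbours; both classes then persist by the two principles above.
  have inv : ∀ s ≤ L, ∀ i, (hi ≤ x 0 i → hi ≤ x s i) ∧ (x 0 i ≤ lo → x s i ≤ lo) := by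
    intro s
    induction s with
    | zero => exact fun _ i => ⟨id, id⟩
    | succ s ih =>
      intro hs i
      have ih := ih (by omega)
      obtain ⟨H1, H2⟩ := H s hs
      rw [hx s hs]
      refine ⟨fun h => ?_, fun h => ?_⟩
      · have hi' := (ih i).1 h
        refine le_step_apply (hδ0 s) (hδ1 s) hi' (fun hm => absurd hi' (H2 i hm).not_ge)
          fun j hj => ?_
        rcases hsep j with h' | h'
        · exact absurd ((ih j).2 h') (H1 i j hj hi').not_ge
        · exact (ih j).1 h'
      · have hi' := (ih i).2 h
        refine step_apply_le (hδ0 s) (hδ1 s) hlo hi' fun j hj => ?_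
        rcases hsep j with h' | h'
        · exact (ih j).2 h'
        · exact absurd hi' (H1 j i hj.symm ((ih j).1 h')).not_ge
  obtain ⟨a, ha⟩ := htop
  by_cases hall : ∀ i, hi ≤ x 0 i
  · obtain ⟨s, hs, i, hiS⟩ := hS
    exact absurd ((inv s hs.le i).1 (hall i)) ((H s hs).2 i hiS).not_ge
  · push Not at hall
    obtain ⟨b, hb⟩ := hall
    obtain ⟨s, hs, i, hi1, j, hj1, hadj⟩ :=
      exists_adj_of_connected_iSup hG {i | hi ≤ x 0 i} ha hb.not_ge
    have hj2 : x 0 j ≤ lo := (hsep j).resolve_right hj1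
    exact absurd ((inv s hs.le j).2 hj2) ((H s hs).1 i j hadj ((inv s hs.le i).1 hi1)).not_ge

/-- Squared increments of a monotone sequence inside an interval. -/
theorem sum_sq_gap_le {y : ℕ → ℝ} (hy : Monotone y) (F : Finset ℕ) {lo up : ℝ}
    (h : ∀ k ∈ F, lo ≤ y k ∧ y (k + 1) ≤ up) :
    ∑ k ∈ F, (y (k + 1) - y k) ^ 2 ≤ (max (up - lo) 0) ^ 2 := by
  have hg : ∀ k, 0 ≤ y (k + 1) - y k := fun k => sub_nonneg.2 (hy k.le_succ)
  rcases F.eq_empty_or_nonempty with rfl | hF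
  · simp
  have h1 : ∑ k ∈ F, (y (k + 1) - y k) ≤ up - lo := by
    calc ∑ k ∈ F, (y (k + 1) - y k)
        ≤ ∑ k ∈ Finset.Ico (F.min' hF) (F.max' hF + 1), (y (k + 1) - y k) := by
          refine Finset.sum_le_sum_of_subset_of_nonneg (fun k hk => ?_) fun k _ _ => hg k
          rw [Finset.mem_Ico]
          exact ⟨F.min'_le k hk, Nat.lt_succ_of_le (F.le_max' k hk)⟩
      _ = y (F.max' hF + 1) - y (F.min' hF) := by
          rw [Finset.sum_Ico_sub]
          exact (F.min'_le _ (F.max'_mem hF)).trans (Nat.le_succ _)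
      _ ≤ up - lo := by
          linarith [(h _ (F.min'_mem hF)).1, (h _ (F.max'_mem hF)).2]
  have h2 : ∑ k ∈ F, (y (k + 1) - y k) ^ 2 ≤ (∑ k ∈ F, (y (k + 1) - y k)) ^ 2 :=
    Finset.sum_sq_le_sq_sum_of_nonneg fun k _ => hg k
  refine h2.trans (pow_le_pow_left₀ (Finset.sum_nonneg fun k _ => hg k) ?_ 2)
  exact h1.trans (le_max_left _ _)

/-- Keeping the positive part counts each unordered pair once, which is what the energy does;
ordered crossings can thus be charged without losing a factor two. -/
theorem sum_weight_posPart (G : SimpleGraph (Fin n)) (x : Fin n → ℝ) :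
    ∑ i, ∑ j, weight G i j * (max (x i - x j) 0) ^ 2
      = (∑ i, ∑ j, weight G i j * (x i - x j) ^ 2) / 2 := by
  have h : ∑ i, ∑ j, weight G i j * (max (x i - x j) 0) ^ 2
      = ∑ i, ∑ j, weight G i j * (max (x j - x i) 0) ^ 2 := by
    rw [Finset.sum_comm]
    exact Finset.sum_congr rfl fun i _ => Finset.sum_congr rfl fun j _ => by
      rw [weight_comm G j i]
  rw [eq_div_iff two_ne_zero, mul_two]
  nth_rewrite 2 [h]
  rw [← Finset.sum_add_distrib]
  refine Finset.sum_congr rfl fun i _ => ?_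
  rw [← Finset.sum_add_distrib]
  refine Finset.sum_congr rfl fun j _ => ?_
  rcases le_total (x i) (x j) with hij | hij
  · rw [max_eq_right (by linarith), max_eq_left (by linarith)]; ring
  · rw [max_eq_left (by linarith), max_eq_right (by linarith)]; ring

/-- The nonnegative thresholds that separate the entries of `x`. -/
theorem exists_thresholds (x : Fin n → ℝ) (a : Fin n) (ha : 0 ≤ x a) (hmax : ∀ i, x i ≤ x a) :
    ∃ y : ℕ → ℝ, Monotone y ∧ y 0 = 0 ∧ y n = x a ∧
      ∀ k i, x i ≤ y k ∨ y (k + 1) ≤ x i := by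
  set z : Fin n → NNReal := fun i => (x i).toNNReal with hz
  set σ := Tuple.sort z
  have hσ : Monotone (z ∘ σ) := Tuple.monotone_sort z
  -- The threshold `y k` is the largest positive part among the `k` smallest entries. The supremum
  -- is taken in `NNReal`, so the empty case gives `y 0 = 0`.
  refine ⟨fun k => ((Finset.univ.filter fun i => (σ.symm i : ℕ) < k).sup z : NNReal),
    ?_, ?_, ?_, ?_⟩
  · intro k l hkl
    refine NNReal.coe_le_coe.2 (Finset.sup_mono fun i hi => ?_)
    simp only [Finset.mem_filter, Finset.mem_univ, true_and] at hi ⊢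
    omega
  · simp
  · have : (Finset.univ.filter fun i => (σ.symm i : ℕ) < n).sup z = z a := by
      refine le_antisymm (Finset.sup_le fun i _ => Real.toNNReal_le_toNNReal (hmax i)) ?_
      exact Finset.le_sup (f := z) (by simp)
    exact (congrArg NNReal.toReal this).trans (Real.coe_toNNReal _ ha)
  · intro k i
    by_cases hk : (σ.symm i : ℕ) < k
    · left
      have : z i ≤ (Finset.univ.filter fun i => (σ.symm i : ℕ) < k).sup z :=
        Finset.le_sup (f := z) (by simpa using hk)
      exact (Real.le_coe_toNNReal _).trans (NNReal.coe_le_coe.2 this)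
    · have hle : (Finset.univ.filter fun i => (σ.symm i : ℕ) < k + 1).sup z ≤ z i := by
        refine Finset.sup_le fun i' hi' => ?_
        simp only [Finset.mem_filter, Finset.mem_univ, true_and] at hi'
        have : σ.symm i' ≤ σ.symm i := by
          rw [Fin.le_def]; omega
        simpa using hσ this
      rcases le_total 0 (x i) with h0 | h0
      · right
        refine (NNReal.coe_le_coe.2 hle).trans ?_
        rw [hz, Real.coe_toNNReal _ h0]
      · left
        exact h0.trans (NNReal.coe_nonneg _)

/-- The largest entry is controlled by the energies along the trajectory. -/
theorem sq_max_le_sum_energy {L : ℕ} {δ : ℕ → ℝ} (hδ0 : ∀ s, 0 ≤ δ s) (hδ1 : ∀ s, δ s ≤ 1)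
    {G : ℕ → SimpleGraph (Fin n)} {S : ℕ → Finset (Fin n)} {x : ℕ → Fin n → ℝ}
    (hx : ∀ s < L, x (s + 1) = step (δ s) (G s) (S s) (x s))
    (hG : (⨆ s ∈ Finset.range L, G s).Connected) (hS : ∃ s < L, (S s).Nonempty)
    {d : ℝ} (hd1 : 1 ≤ d) (hd : ∀ s i j, maxDeg (G s) i j ≤ d)
    (a : Fin n) (ha : 0 ≤ x 0 a) (hmax : ∀ i, x 0 i ≤ x 0 a) :
    x 0 a ^ 2 ≤ n * (d * ∑ s ∈ Finset.range L, energy (G s) (S s) (x s)) := by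
  classical
  obtain ⟨y, hy, hy0, hyn, hsep⟩ := exists_thresholds (x 0) a ha hmax
  have : Nonempty (Fin n) := ⟨a⟩
  -- A triple `(s, i, o)` encodes a crossing at time `s`: `some j` is the edge from `i` down to `j`,
  -- `none` is a measurement at `i`, whose lower end is `0`.
  set low : ℕ × Fin n × Option (Fin n) → ℝ := fun p => p.2.2.elim 0 (x p.1) with hlow
  have hyle : ∀ k < n, y (k + 1) ≤ x 0 a := fun k hk => by
    rw [← hyn]; exact hy hk
  have hcross : ∀ k ∈ Finset.range n, ∃ p : ℕ × Fin n × Option (Fin n), p.1 < L ∧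
      low p ≤ y k ∧ y (k + 1) ≤ x p.1 p.2.1 ∧
      (p.2.2.elim (p.2.1 ∈ S p.1) fun j => (G p.1).Adj p.2.1 j) := by
    intro k hk
    rw [Finset.mem_range] at hk
    have hk0 : 0 ≤ y k := hy0 ▸ hy (Nat.zero_le k)
    obtain ⟨s, hs, ⟨i, j, h1, h2, h3⟩ | ⟨i, h1, h2⟩⟩ := exists_crossing hδ0 hδ1 hx hG hS hk0
      (hsep k) ⟨a, hyle k hk⟩
    · exact ⟨(s, i, some j), hs, h3, h2, h1⟩
    · exact ⟨(s, i, none), hs, hk0, h2, h1⟩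
  choose! f hf1 hf2 hf3 hf4 using hcross
  set c : ℕ → Fin n → Option (Fin n) → ℝ := fun s i o =>
    o.elim (if i ∈ S s then x s i ^ 2 else 0)
      fun j => d * (weight (G s) i j * (max (x s i - x s j) 0) ^ 2) with hc
  have hc0 : ∀ s i o, 0 ≤ c s i o := by
    rintro s i (_ | j)
    · simp only [hc, Option.elim]; split_ifs
      · exact sq_nonneg _
      · exact le_rfl
    · exact mul_nonneg (by linarith) (mul_nonneg (weight_nonneg _ _ _) (sq_nonneg _))
  -- Gaps charged to the same crossing are disjoint and lie in its interval, so their squares add up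
  -- to at most the squared length; for an edge, `d · weight ≥ 1` turns this into an energy term.
  have hfib : ∀ p : ℕ × Fin n × Option (Fin n),
      ∑ k ∈ Finset.range n with f k = p, (y (k + 1) - y k) ^ 2 ≤ c p.1 p.2.1 p.2.2 := by
    intro p
    rcases ((Finset.range n).filter fun k => f k = p).eq_empty_or_nonempty with he | ⟨k0, hk0⟩
    · rw [he, Finset.sum_empty]; exact hc0 _ _ _
    · rw [Finset.mem_filter] at hk0
      have hb := sum_sq_gap_le hy ((Finset.range n).filter fun k => f k = p) (lo := low p)
        (up := x p.1 p.2.1) (fun k hk => by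
          rw [Finset.mem_filter] at hk
          obtain ⟨hk, rfl⟩ := hk
          exact ⟨hf2 k hk, hf3 k hk⟩)
      refine hb.trans ?_
      have h4 := hf4 k0 hk0.1
      have h3 := hf3 k0 hk0.1
      rw [hk0.2] at h4 h3
      rcases p with ⟨s, i, _ | j⟩
      · simp only [Option.elim] at h4
        simp only [hc, hlow, Option.elim, if_pos h4, sub_zero]
        rw [max_eq_left]
        exact le_trans (by rw [← hy0]; exact hy (Nat.zero_le _)) h3
      · simp only [Option.elim] at h4
        simp only [hc, hlow, Option.elim]
        rw [← mul_assoc]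
        refine le_mul_of_one_le_left (sq_nonneg _) ?_
        rw [weight, if_pos h4, mul_one_div, one_le_div (by linarith [one_le_maxDeg h4])]
        exact hd s i j
  have hsumF : ∑ k ∈ Finset.range n, (y (k + 1) - y k) ^ 2
      ≤ d * ∑ s ∈ Finset.range L, energy (G s) (S s) (x s) := by
    have hmaps : ∀ k ∈ Finset.range n, f k ∈ Finset.range L ×ˢ (Finset.univ : Finset (Fin n × Option (Fin n))) :=
      fun k hk => by simpa using hf1 k hk
    rw [← Finset.sum_fiberwise_of_maps_to hmaps, Finset.mul_sum]
    refine (Finset.sum_le_sum fun p _ => hfib p).trans ?_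
    rw [Finset.sum_product]
    refine Finset.sum_le_sum fun s _ => ?_
    rw [Fintype.sum_prod_type]
    simp only [Fintype.sum_option, hc, Option.elim]
    rw [Finset.sum_add_distrib, Finset.sum_ite_mem, Finset.univ_inter]
    simp only [← Finset.mul_sum]
    rw [sum_weight_posPart, energy, mul_add]
    have : 0 ≤ ∑ i ∈ S s, x s i ^ 2 := Finset.sum_nonneg fun _ _ => sq_nonneg _
    nlinarith
  have htel : x 0 a = ∑ k ∈ Finset.range n, (y (k + 1) - y k) := by
    rw [Finset.sum_range_sub, hyn, hy0, sub_zero]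
  calc x 0 a ^ 2 = (∑ k ∈ Finset.range n, (y (k + 1) - y k)) ^ 2 := by rw [← htel]
    _ ≤ n * ∑ k ∈ Finset.range n, (y (k + 1) - y k) ^ 2 := by
        simpa using sq_sum_le_card_mul_sum_sq (s := Finset.range n)
          (f := fun k => y (k + 1) - y k)
    _ ≤ _ := mul_le_mul_of_nonneg_left hsumF (Nat.cast_nonneg _)

theorem energy_neg (G : SimpleGraph (Fin n)) (S : Finset (Fin n)) (x : Fin n → ℝ) :
    energy G S (-x) = energy G S x := by
  unfold energy
  simp only [Pi.neg_apply, neg_sq]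
  congr 2
  exact Finset.sum_congr rfl fun i _ => Finset.sum_congr rfl fun j _ => by ring

/-- The initial squared norm is controlled by the energies along the trajectory, when the graphs
are jointly connected and a measurement is made. -/
theorem sqNorm_le_sum_energy {L : ℕ} {δ : ℕ → ℝ} (hδ0 : ∀ s, 0 ≤ δ s) (hδ1 : ∀ s, δ s ≤ 1)
    {G : ℕ → SimpleGraph (Fin n)} {S : ℕ → Finset (Fin n)} {x : ℕ → Fin n → ℝ}
    (hx : ∀ s < L, x (s + 1) = step (δ s) (G s) (S s) (x s))
    (hG : (⨆ s ∈ Finset.range L, G s).Connected) (hS : ∃ s < L, (S s).Nonempty)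
    {d : ℝ} (hd1 : 1 ≤ d) (hd : ∀ s i j, maxDeg (G s) i j ≤ d) :
    sqNorm (x 0) ≤ n ^ 2 * d * ∑ s ∈ Finset.range L, energy (G s) (S s) (x s) := by
  obtain ⟨s0, -, i0, -⟩ := id hS
  have : Nonempty (Fin n) := ⟨i0⟩
  obtain ⟨a, ha⟩ := Finite.exists_max fun i => |x 0 i|
  have hmain : x 0 a ^ 2 ≤ n * (d * ∑ s ∈ Finset.range L, energy (G s) (S s) (x s)) := by
    rcases le_total 0 (x 0 a) with h0 | h0
    · exact sq_max_le_sum_energy hδ0 hδ1 hx hG hS hd1 hd a h0 fun i =>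
        (le_abs_self _).trans ((ha i).trans_eq (abs_of_nonneg h0))
    · have h := sq_max_le_sum_energy (x := fun s => -x s) hδ0 hδ1
        (fun s hs => by rw [hx s hs, map_neg]) hG hS hd1 hd a
        (by simpa using h0) fun i =>
          (neg_le_abs _).trans ((ha i).trans_eq (abs_of_nonpos h0))
      simpa only [energy_neg, Pi.neg_apply, neg_sq] using h
  calc sqNorm (x 0) ≤ ∑ _i : Fin n, x 0 a ^ 2 :=
        Finset.sum_le_sum fun i _ => sq_le_sq.2 (ha i)
    _ = n * x 0 a ^ 2 := by simp
    _ ≤ n * (n * (d * ∑ s ∈ Finset.range L, energy (G s) (S s) (x s))) :=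
        mul_le_mul_of_nonneg_left hmain (Nat.cast_nonneg _)
    _ = _ := by ring

end Crossing

/-! ### Hitting times of the lazy Metropolis walk and the resulting Poincaré inequality. -/

section Hitting

variable {n : ℕ}

theorem maxDeg_le (G : SimpleGraph (Fin n)) (i j : Fin n) : maxDeg G i j ≤ n := by
  classical
  refine max_le ?_ ?_ <;>
  · refine Nat.cast_le.2 ((SimpleGraph.degree_lt_card_verts _).le.trans ?_)
    rw [Fintype.card_fin]

/-- Identifies the transition operator with the noiseless step for `δ = 1` and no measurements, so
the energy estimates apply to the walk. -/
theorem sum_lazyMetropolis_mul (G : SimpleGraph (Fin n)) (f : Fin n → ℝ) (i : Fin n) :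
    ∑ k, lazyMetropolis G i k * f k = step 1 G ∅ f i := by
  have h1 : ∀ k, lazyMetropolis G i k * f k
      = (if i = k then f k else 0) - (if i = k then (∑ l, weight G i l / 4) * f k else 0)
        + weight G i k / 4 * f k := by
    intro k
    unfold lazyMetropolis
    simp only [moveProb_eq]
    split_ifs with h
    · subst h; rw [weight_self]; ring
    · ring
  simp only [h1, Finset.sum_add_distrib, Finset.sum_sub_distrib, Finset.sum_ite_eq,
    Finset.mem_univ, if_true, step_apply, Finset.notMem_empty, if_false, zero_add]
  rw [Finset.mul_sum, Finset.sum_mul, sub_add, ← Finset.sum_sub_distrib]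
  congr 1
  exact Finset.sum_congr rfl fun k _ => by ring

theorem avoidProb_zero (G : SimpleGraph (Fin n)) (i j : Fin n) :
    avoidProb G i j 0 = if i = j then 0 else 1 := by
  classical
  unfold avoidProb
  rw [Finset.sum_filter, ← (Equiv.funUnique (Fin 1) (Fin n)).symm.sum_comp]
  have : ∀ a : Fin n, ((Equiv.funUnique (Fin 1) (Fin n)).symm a 0 = i ∧
      ∀ s, (Equiv.funUnique (Fin 1) (Fin n)).symm a s ≠ j) ↔ (i = a ∧ i ≠ j) := by
    intro a
    simp only [Equiv.funUnique_symm_apply, uniqueElim_const, forall_const]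
    exact ⟨fun h => ⟨h.1.symm, h.1 ▸ h.2⟩, fun h => ⟨h.1.symm, h.1 ▸ h.2⟩⟩
  simp only [this, Finset.univ_eq_empty, Finset.prod_empty]
  by_cases h : i = j <;> simp [h]

theorem avoidProb_succ (G : SimpleGraph (Fin n)) (i j : Fin n) (k : ℕ) :
    avoidProb G i j (k + 1)
      = if i = j then 0 else ∑ l, lazyMetropolis G i l * avoidProb G l j k := by
  classical
  unfold avoidProb
  rw [Finset.sum_filter, ← (Fin.consEquiv fun _ : Fin (k + 2) => Fin n).sum_comp,
    Fintype.sum_prod_type]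
  have hL : ∀ (a : Fin n) (y : Fin (k + 1) → Fin n),
      (if (Fin.consEquiv fun _ : Fin (k + 2) => Fin n) (a, y) 0 = i ∧
          ∀ s, (Fin.consEquiv fun _ : Fin (k + 2) => Fin n) (a, y) s ≠ j then
        ∏ s : Fin (k + 1), lazyMetropolis G
          ((Fin.consEquiv fun _ : Fin (k + 2) => Fin n) (a, y) s.castSucc)
          ((Fin.consEquiv fun _ : Fin (k + 2) => Fin n) (a, y) s.succ) else 0)
      = if i = a then (if i = j then 0 else if ∀ s, y s ≠ j then
          lazyMetropolis G i (y 0) * ∏ s : Fin k, lazyMetropolis G (y s.castSucc) (y s.succ)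
          else 0) else 0 := by
    intro a y
    simp only [Fin.consEquiv, Equiv.coe_fn_mk, Fin.cons_zero, Fin.forall_fin_succ, Fin.cons_succ,
      Fin.prod_univ_succ, Fin.castSucc_zero, ← Fin.succ_castSucc]
    by_cases ha : i = a
    · subst ha
      by_cases hj : i = j <;> simp [hj]
    · simp [ha, Ne.symm ha]
  simp only [hL]
  rw [Finset.sum_comm]
  simp only [Finset.sum_ite_eq, Finset.mem_univ, if_true]
  split_ifs with h
  · simp
  · simp only [Finset.sum_filter, Finset.mul_sum]
    rw [Finset.sum_comm]
    refine Finset.sum_congr rfl fun y _ => ?_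
    by_cases hy : ∀ s, y s ≠ j
    · simp [hy]
    · simp [hy]

/-- A walk started at `j` visits `j`. -/
theorem avoidProb_self (G : SimpleGraph (Fin n)) (j : Fin n) (k : ℕ) : avoidProb G j j k = 0 := by
  cases k
  · simp [avoidProb_zero]
  · simp [avoidProb_succ]

theorem avoidProb_nonneg (G : SimpleGraph (Fin n)) (i j : Fin n) (k : ℕ) :
    0 ≤ avoidProb G i j k := by
  induction k generalizing i with
  | zero => rw [avoidProb_zero]; split_ifs <;> norm_num
  | succ k ih =>
    rw [avoidProb_succ]
    split_ifs
    · exact le_rfl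
    · rw [sum_lazyMetropolis_mul]
      exact le_step_apply zero_le_one le_rfl (ih i) (Finset.notMem_empty i) fun l _ => ih l

theorem sqNorm_le_energy {G : SimpleGraph (Fin n)} (hG : G.Connected) (j : Fin n)
    (x : Fin n → ℝ) : sqNorm x ≤ n ^ 3 * energy G {j} x := by
  have hn : (1 : ℝ) ≤ n := by exact_mod_cast Nat.one_le_iff_ne_zero.2 (Fin.pos j).ne'
  have h := sqNorm_le_sum_energy (L := 1) (δ := fun _ => 1) (fun _ => zero_le_one)
    (fun _ => le_rfl) (G := fun _ => G) (S := fun _ => {j})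
    (x := fun s => s.rec x fun _ y => step 1 G {j} y) (fun s _ => rfl)
    (by simpa using hG) ⟨0, one_pos, Finset.singleton_nonempty j⟩ hn fun _ i k => maxDeg_le G i k
  simp only [Finset.sum_range_one] at h
  calc sqNorm x ≤ n ^ 2 * n * energy G {j} x := h
    _ = _ := by ring

/-- The avoidance vector at time `k + 1` is the transition operator applied to that at time `k`,
then set to zero at `j`. Each application loses a quarter of the energy, bounded below by the cubic
Poincaré inequality. -/
theorem sqNorm_avoidProb_le {G : SimpleGraph (Fin n)} (hG : G.Connected) (j : Fin n) (k : ℕ) :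
    sqNorm (fun i => avoidProb G i j k) ≤ (1 - 1 / (4 * (n : ℝ) ^ 3)) ^ k * n := by
  have hn : (1 : ℝ) ≤ n := by exact_mod_cast Nat.one_le_iff_ne_zero.2 (Fin.pos j).ne'
  have hn3 : (1 : ℝ) ≤ (n : ℝ) ^ 3 := one_le_pow₀ hn
  have hq : 0 ≤ 1 - 1 / (4 * (n : ℝ) ^ 3) := by
    rw [sub_nonneg, div_le_one (by positivity)]
    linarith
  induction k with
  | zero =>
    simp only [avoidProb_zero, sqNorm, pow_zero, one_mul]
    calc ∑ i : Fin n, (if i = j then (0 : ℝ) else 1) ^ 2 ≤ ∑ _i : Fin n, (1 : ℝ) :=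
          Finset.sum_le_sum fun i _ => by split_ifs <;> norm_num
      _ = n := by simp
  | succ k ih =>
    set a : Fin n → ℝ := fun i => avoidProb G i j k with ha
    have haj : a j = 0 := avoidProb_self G j k
    have h1 : sqNorm (fun i => avoidProb G i j (k + 1)) ≤ sqNorm (step 1 G ∅ a) := by
      refine Finset.sum_le_sum fun i _ => ?_
      simp only [avoidProb_succ, sum_lazyMetropolis_mul]
      split_ifs
      · simpa using sq_nonneg _
      · exact le_rfl
    have h2 := sqNorm_step_le zero_le_one le_rfl G ∅ a
    have h3 := sqNorm_le_energy hG j a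
    -- The avoidance vector vanishes at `j`, so the measurement term needed for the Poincaré
    -- inequality is free.
    have h4 : energy G {j} a = energy G ∅ a := by simp [energy, haj]
    rw [h4] at h3
    have h5 : sqNorm a / n ^ 3 ≤ energy G ∅ a := by
      rw [div_le_iff₀ (by positivity)]; linarith
    calc sqNorm (fun i => avoidProb G i j (k + 1))
        ≤ sqNorm a - 1 / 4 * (sqNorm a / n ^ 3) := by linarith
      _ = (1 - 1 / (4 * (n : ℝ) ^ 3)) * sqNorm a := by field_simp
      _ ≤ (1 - 1 / (4 * (n : ℝ) ^ 3)) * ((1 - 1 / (4 * (n : ℝ) ^ 3)) ^ k * n) :=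
          mul_le_mul_of_nonneg_left ih hq
      _ = _ := by ring

/-- A geometric bound on avoidance probabilities, uniform over connected graphs. -/
theorem exists_avoidProb_le (n : ℕ) : ∃ C q : ℝ, 0 ≤ q ∧ q < 1 ∧
    ∀ G : SimpleGraph (Fin n), G.Connected → ∀ i j k, avoidProb G i j k ≤ C * q ^ k := by
  rcases Nat.eq_zero_or_pos n with rfl | hn0
  · exact ⟨0, 0, le_rfl, one_pos, fun G _ i => i.elim0⟩
  have hn : (1 : ℝ) ≤ n := by exact_mod_cast hn0
  have hn3 : (1 : ℝ) ≤ (n : ℝ) ^ 3 := one_le_pow₀ hn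
  have hq : 0 ≤ 1 - 1 / (4 * (n : ℝ) ^ 3) := by
    rw [sub_nonneg, div_le_one (by positivity)]
    linarith
  refine ⟨Real.sqrt n, Real.sqrt (1 - 1 / (4 * (n : ℝ) ^ 3)), Real.sqrt_nonneg _, ?_, ?_⟩
  · rw [Real.sqrt_lt' one_pos]
    have : 0 < 1 / (4 * (n : ℝ) ^ 3) := by positivity
    linarith
  · intro G hG i j k
    refine (sq_le_sq₀ (avoidProb_nonneg G i j k) (by positivity)).1 ?_
    rw [mul_pow, ← pow_mul, mul_comm k 2, pow_mul, Real.sq_sqrt (by linarith), Real.sq_sqrt hq,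
      mul_comm]
    refine le_trans ?_ (sqNorm_avoidProb_le hG j k)
    exact Finset.single_le_sum (f := fun i => avoidProb G i j k ^ 2) (fun i _ => sq_nonneg _)
      (Finset.mem_univ i)

theorem summable_avoidProb {G : SimpleGraph (Fin n)} (hG : G.Connected) (i j : Fin n) :
    Summable (avoidProb G i j) := by
  obtain ⟨C, q, hq0, hq1, h⟩ := exists_avoidProb_le n
  exact Summable.of_nonneg_of_le (avoidProb_nonneg G i j) (h G hG i j)
    ((summable_geometric_of_lt_one hq0 hq1).mul_left C)

theorem maxHittingTime_ne_top {G : ℕ → SimpleGraph (Fin n)} (hG : ∀ t, (G t).Connected) :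
    maxHittingTime G ≠ ⊤ := by
  obtain ⟨C, q, hq0, hq1, h⟩ := exists_avoidProb_le n
  refine ne_top_of_le_ne_top (b := ENNReal.ofReal (∑' k, C * q ^ k)) ENNReal.ofReal_ne_top ?_
  refine iSup_le fun t => iSup_le fun i => iSup_le fun j => ?_
  unfold hittingTime
  rw [← ENNReal.ofReal_tsum_of_nonneg (avoidProb_nonneg _ i j) (summable_avoidProb (hG t) i j)]
  exact ENNReal.ofReal_le_ofReal ((summable_avoidProb (hG t) i j).tsum_le_tsum (h _ (hG t) i j)
    ((summable_geometric_of_lt_one hq0 hq1).mul_left C))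

theorem tsum_avoidProb_le {G : ℕ → SimpleGraph (Fin n)} (hG : ∀ t, (G t).Connected) (t : ℕ)
    (i j : Fin n) : ∑' k, avoidProb (G t) i j k ≤ (maxHittingTime G).toReal := by
  rw [← ENNReal.ofReal_le_iff_le_toReal (maxHittingTime_ne_top hG),
    ENNReal.ofReal_tsum_of_nonneg (avoidProb_nonneg _ i j) (summable_avoidProb (hG t) i j)]
  exact le_iSup_of_le t (le_iSup_of_le i (le_iSup_of_le j le_rfl))

/-- First-step equation for the expected hitting times. -/
theorem tsum_avoidProb_eq {G : SimpleGraph (Fin n)} (hG : G.Connected) {i j : Fin n}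
    (hij : i ≠ j) :
    ∑ l, weight G i l * (∑' k, avoidProb G i j k - ∑' k, avoidProb G l j k) = 4 := by
  have h1 := (summable_avoidProb hG i j).tsum_eq_zero_add
  have h2 : ∀ k, avoidProb G i j (k + 1) = ∑ l, lazyMetropolis G i l * avoidProb G l j k :=
    fun k => by rw [avoidProb_succ, if_neg hij]
  have h3 : ∑' k, avoidProb G i j (k + 1)
      = ∑ l, lazyMetropolis G i l * ∑' k, avoidProb G l j k := by
    simp only [h2]
    rw [Summable.tsum_finsetSum fun l _ => (summable_avoidProb hG l j).mul_left _]
    exact Finset.sum_congr rfl fun l _ => tsum_mul_left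
  rw [h3, sum_lazyMetropolis_mul G (fun l => ∑' k, avoidProb G l j k), step_apply, avoidProb_zero,
    if_neg hij, if_neg (Finset.notMem_empty i)] at h1
  linarith

/-- The Dirichlet form dominates a potential given by a superharmonic function. -/
theorem four_mul_sum_div_le {G : SimpleGraph (Fin n)} {j : Fin n} {h x : Fin n → ℝ}
    (hj : h j = 0) (hpos : ∀ i, i ≠ j → 0 < h i)
    (heq : ∀ i, i ≠ j → ∑ l, weight G i l * (h i - h l) = 4) (hx : x j = 0) :
    4 * ∑ i, x i ^ 2 / h i ≤ (∑ i, ∑ l, weight G i l * (x i - x l) ^ 2) / 2 := by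
  have h1 := sum_mul_laplacian G h fun i => x i ^ 2 / h i
  have h2 : ∑ i, x i ^ 2 / h i * ∑ l, weight G i l * (h i - h l) = 4 * ∑ i, x i ^ 2 / h i := by
    rw [Finset.mul_sum]
    refine Finset.sum_congr rfl fun i _ => ?_
    by_cases hi : i = j
    · simp [hi, hj]
    · rw [heq i hi, mul_comm]
  rw [← h2, h1]
  refine div_le_div_of_nonneg_right ?_ zero_le_two
  refine Finset.sum_le_sum fun i _ => Finset.sum_le_sum fun l _ =>
    mul_le_mul_of_nonneg_left ?_ (weight_nonneg G i l)
  -- At `j` the quotient `x² / h` is `0 / 0 = 0`, and edges at `j` give equality. On other edges the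
  -- difference of the two sides is the square `(x i * h l - x l * h i)² / (h i * h l)`.
  by_cases hi : i = j
  · by_cases hl : l = j
    · simp [hi, hl]
    · have := hpos l hl
      subst hi
      rw [hx, hj]
      apply le_of_eq
      field_simp
      ring
  · have hip := hpos i hi
    by_cases hl : l = j
    · subst hl
      rw [hx, hj]
      apply le_of_eq
      field_simp
      ring
    · have hlp := hpos l hl
      have : (x i - x l) ^ 2 - (x i ^ 2 / h i - x l ^ 2 / h l) * (h i - h l)
          = (x i * h l - x l * h i) ^ 2 / (h i * h l) := by
        field_simp
        ring
      have h0 : 0 ≤ (x i * h l - x l * h i) ^ 2 / (h i * h l) := by positivity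
      linarith

theorem one_le_tsum_avoidProb {G : SimpleGraph (Fin n)} (hG : G.Connected) {i j : Fin n}
    (hij : i ≠ j) : 1 ≤ ∑' k, avoidProb G i j k := by
  have := (summable_avoidProb hG i j).le_tsum 0 fun k _ => avoidProb_nonneg G i j k
  rwa [avoidProb_zero, if_neg hij] at this

/-- Expected return times of the lazy Metropolis walk bound the hitting times from below. -/
theorem four_mul_le_of_tsum_avoidProb_le {G : SimpleGraph (Fin n)} (hG : G.Connected) (j : Fin n)
    {H : ℝ} (hH0 : 0 ≤ H) (hH : ∀ i, ∑' k, avoidProb G i j k ≤ H) : 4 * ((n : ℝ) - 1) ≤ H := by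
  set h : Fin n → ℝ := fun i => ∑' k, avoidProb G i j k with hh
  have hj : h j = 0 := by simp [hh, avoidProb_self]
  -- The Laplacian of `h` has total sum zero: its value `4` at each of the `n - 1` nodes other than
  -- `j` must be balanced by `∑ weight G j l * h l`, which is at most `H`.
  have h1 := sum_mul_laplacian G h fun _ => 1
  simp only [one_mul, sub_self, zero_mul, mul_zero, Finset.sum_const_zero, zero_div] at h1
  rw [← Finset.add_sum_erase _ _ (Finset.mem_univ j),
    Finset.sum_congr rfl fun i hi => tsum_avoidProb_eq hG (Finset.ne_of_mem_erase hi)] at h1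
  have h2 : ∑ l, weight G j l * (h j - h l) = - ∑ l, weight G j l * h l := by
    rw [hj, ← Finset.sum_neg_distrib]
    exact Finset.sum_congr rfl fun l _ => by ring
  have h3 : ∑ l, weight G j l * h l ≤ H := by
    calc ∑ l, weight G j l * h l ≤ ∑ l, weight G j l * H :=
          Finset.sum_le_sum fun l _ => mul_le_mul_of_nonneg_left (hH l) (weight_nonneg G j l)
      _ ≤ H := by
          rw [← Finset.sum_mul]
          exact mul_le_of_le_one_left hH0 (sum_weight_le_one G j)
  rw [h2, Finset.sum_const, Finset.card_erase_of_mem (Finset.mem_univ j), Finset.card_univ,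
    Fintype.card_fin, nsmul_eq_mul, Nat.cast_sub (Fin.pos j)] at h1
  push_cast at h1
  linarith

/-- On a connected graph the energy with a measurement is bounded below through hitting times. -/
theorem sqNorm_le_hitting_mul_energy (hn : 2 ≤ n) {G : SimpleGraph (Fin n)} (hG : G.Connected)
    {S : Finset (Fin n)} (hS : S.Nonempty) {H : ℝ}
    (hH : ∀ i j, ∑' k, avoidProb G i j k ≤ H) (x : Fin n → ℝ) :
    sqNorm x ≤ H * energy G S x := by
  obtain ⟨j, hjS⟩ := hS
  have hn' : (2 : ℝ) ≤ n := by exact_mod_cast hn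
  have hH0 : 0 ≤ H := le_trans (by simp [avoidProb_self]) (hH j j)
  have hHn := four_mul_le_of_tsum_avoidProb_le hG j hH0 fun i => hH i j
  have hHpos : 0 < H := by linarith
  set h : Fin n → ℝ := fun i => ∑' k, avoidProb G i j k with hh
  set y : Fin n → ℝ := fun i => x i - x j with hy
  have hpos : ∀ i, i ≠ j → 0 < h i := fun i hi =>
    zero_lt_one.trans_le (one_le_tsum_avoidProb hG hi)
  have hyj : y j = 0 := sub_self _
  have h1 := four_mul_sum_div_le (G := G) (x := y) (by simp [hh, avoidProb_self]) hpos
    (fun i hi => tsum_avoidProb_eq hG hi) hyj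
  have h2 : (∑ i, y i ^ 2) / H ≤ ∑ i, y i ^ 2 / h i := by
    rw [Finset.sum_div]
    refine Finset.sum_le_sum fun i _ => ?_
    by_cases hi : i = j
    · simp [hi, hyj]
    · exact div_le_div_of_nonneg_left (sq_nonneg _) (hpos i hi) (hH i j)
  have h3 : ∑ i, ∑ l, weight G i l * (y i - y l) ^ 2 = ∑ i, ∑ l, weight G i l * (x i - x l) ^ 2 := by
    simp only [hy, sub_sub_sub_cancel_right]
  rw [h3] at h1
  have h4 : x j ^ 2 ≤ ∑ i ∈ S, x i ^ 2 :=
    Finset.single_le_sum (f := fun i => x i ^ 2) (fun i _ => sq_nonneg _) hjS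
  have h5 : sqNorm x ≤ 2 * ∑ i, y i ^ 2 + (2 * n - 1) * x j ^ 2 := by
    have h6 : ∑ i ∈ Finset.univ.erase j, x i ^ 2
        ≤ ∑ i ∈ Finset.univ.erase j, (2 * y i ^ 2 + 2 * x j ^ 2) :=
      Finset.sum_le_sum fun i _ => by
        simp only [hy]
        nlinarith [sq_nonneg (x i - 2 * x j)]
    rw [Finset.sum_add_distrib, ← Finset.mul_sum, Finset.sum_const,
      Finset.card_erase_of_mem (Finset.mem_univ j), Finset.card_univ,
      Fintype.card_fin, nsmul_eq_mul, Nat.cast_sub (Fin.pos j)] at h6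
    push_cast at h6
    have h7 := Finset.add_sum_erase Finset.univ (fun i => x i ^ 2) (Finset.mem_univ j)
    have h8 := Finset.add_sum_erase Finset.univ (fun i => y i ^ 2) (Finset.mem_univ j)
    simp only [hyj] at h7 h8
    unfold sqNorm
    linarith
  have h9 : 4 * ∑ i, y i ^ 2 ≤ H * ((∑ i, ∑ l, weight G i l * (x i - x l) ^ 2) / 2) := by
    have := mul_le_mul_of_nonneg_left ((mul_le_mul_of_nonneg_left h2 zero_le_four).trans h1) hH0
    calc 4 * ∑ i, y i ^ 2 = H * (4 * ((∑ i, y i ^ 2) / H)) := by field_simp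
      _ ≤ _ := this
  -- Here `2n - 1 ≤ 4(n - 1) ≤ H` for `n ≥ 2`, so the cost of shifting by the constant `x j` is paid
  -- by the measurement term.
  have h10 : (2 * n - 1) * x j ^ 2 ≤ H * ∑ i ∈ S, x i ^ 2 :=
    mul_le_mul (by linarith) h4 (sq_nonneg _) hH0
  have h11 : 0 ≤ ∑ i, y i ^ 2 := Finset.sum_nonneg fun _ _ => sq_nonneg _
  unfold energy
  rw [mul_add]
  linarith

end Hitting

/-! ### Products of contracting windows. -/

section Contraction

variable {n : ℕ} {A : ℕ → (Fin n → ℝ) →ₗ[ℝ] (Fin n → ℝ)}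

theorem sqNorm_propagate_le (hA : ∀ s x, sqNorm (A s x) ≤ sqNorm x) (s k : ℕ) (x : Fin n → ℝ) :
    sqNorm (propagate A s k x) ≤ sqNorm x := by
  induction k with
  | zero => exact le_rfl
  | succ k ih => exact (hA _ _).trans ih

/-- A sequence of contracting windows followed by a nonexpansive remainder. -/
theorem sqNorm_propagate_windows_le (hA : ∀ s x, sqNorm (A s x) ≤ sqNorm x) {L : ℕ} {c : ℕ → ℝ}
    (hc : ∀ k, 0 ≤ c k)
    (hw : ∀ k x, sqNorm (propagate A (k * L + 1) L x) ≤ c k * sqNorm x)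
    (k m r : ℕ) (x : Fin n → ℝ) :
    sqNorm (propagate A (k * L + 1) (m * L + r) x)
      ≤ (∏ i ∈ Finset.range m, c (k + i)) * sqNorm x := by
  rw [propagate_add]
  refine (sqNorm_propagate_le hA _ _ _).trans ?_
  induction m with
  | zero => simp [propagate]
  | succ m ih =>
    rw [Nat.succ_mul, propagate_add, Finset.prod_range_succ, mul_comm (∏ i ∈ _, _), mul_assoc]
    have : k * L + 1 + m * L = (k + m) * L + 1 := by ring
    rw [this]
    exact (hw _ _).trans (mul_le_mul_of_nonneg_left ih (hc _))

theorem sqNorm_propagate_one_le (hA : ∀ s x, sqNorm (A s x) ≤ sqNorm x) {L : ℕ} {κ : ℝ}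
    {Δ : ℕ → ℝ} (hκ : ∀ s, κ * Δ s ≤ 1)
    (hw : ∀ k x, sqNorm (propagate A (k * L + 1) L x) ≤ (1 - κ * Δ ((k + 1) * L)) * sqNorm x)
    (t : ℕ) (x : Fin n → ℝ) :
    sqNorm (propagate A 1 (t - 1) x)
      ≤ Real.exp (-(κ * ∑ i ∈ Finset.range ((t - 1) / L), Δ ((i + 1) * L))) * sqNorm x := by
  have h := sqNorm_propagate_windows_le hA (c := fun k => 1 - κ * Δ ((k + 1) * L))
    (fun k => sub_nonneg.2 (hκ _)) hw 0 ((t - 1) / L) ((t - 1) % L) x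
  rw [zero_mul, zero_add, Nat.div_add_mod'] at h
  refine h.trans (mul_le_mul_of_nonneg_right ?_ (sqNorm_nonneg x))
  rw [Finset.mul_sum, ← Finset.sum_neg_distrib, Real.exp_sum]
  refine Finset.prod_le_prod (fun i _ => sub_nonneg.2 (hκ _)) fun i _ => ?_
  rw [zero_add]
  have := Real.add_one_le_exp (-(κ * Δ ((i + 1) * L)))
  linarith

/-- Noise injected at time `r` enters the error at time `r + 1`. Windows start at `k * L + 1`, so
the first full one after it has index `⌈r / L⌉ = (r + L - 1) / L`, and `(t - 1) / L` windows are
complete by time `t`. Truncated subtraction covers the case of no full window. -/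
theorem sqNorm_propagate_le_pow (hA : ∀ s x, sqNorm (A s x) ≤ sqNorm x) {L : ℕ} (hL : 0 < L)
    {κ δ : ℝ} {Δ : ℕ → ℝ} (hκ0 : 0 ≤ κ) {t : ℕ} (hδ : ∀ s < t, δ ≤ Δ s) (hq : κ * δ ≤ 1)
    (hw : ∀ k x, sqNorm (propagate A (k * L + 1) L x) ≤ (1 - κ * Δ ((k + 1) * L)) * sqNorm x)
    {r : ℕ} (x : Fin n → ℝ) :
    sqNorm (propagate A (r + 1) (t - (r + 1)) x)
      ≤ (1 - κ * δ) ^ ((t - 1) / L - (r + L - 1) / L) * sqNorm x := by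
  set m := (t - 1) / L with hm
  set c := (r + L - 1) / L with hc
  have hmt : m * L ≤ t - 1 := Nat.div_mul_le_self _ _
  rcases le_or_gt m c with hmc | hmc
  · rw [Nat.sub_eq_zero_of_le hmc, pow_zero, one_mul]
    exact sqNorm_propagate_le hA _ _ _
  · have hrc : r ≤ c * L := by
      have := Nat.lt_div_mul_add (a := r + L - 1) hL
      rw [← hc] at this
      omega
    have hcm : (m - c) * L + c * L ≤ t - 1 := by rw [← Nat.add_mul, Nat.sub_add_cancel hmc.le]; exact hmt
    set N := m - c with hN
    have hN1 : 0 < N := by omega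
    have ht : 0 < t := by
      have : 0 < N * L := Nat.mul_pos hN1 hL
      omega
    have e : t - (r + 1) = (c * L - r) + (N * L + (t - 1 - c * L - N * L)) := by omega
    rw [e, propagate_add, show r + 1 + (c * L - r) = c * L + 1 by omega]
    have hwin : ∀ M ≤ N, ∀ y, sqNorm (propagate A (c * L + 1) (M * L) y)
        ≤ (1 - κ * δ) ^ M * sqNorm y := by
      intro M
      induction M with
      | zero => intro _ y; simp [propagate]
      | succ M ih =>
        intro hM y
        rw [Nat.succ_mul, propagate_add, show c * L + 1 + M * L = (c + M) * L + 1 by ring, pow_succ',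
          mul_assoc]
        have h1 : (c + M + 1) * L < t := by
          have : (c + M + 1) * L ≤ (N + c) * L := Nat.mul_le_mul_right L (by omega)
          rw [Nat.add_mul N c L] at this
          omega
        refine (hw _ _).trans ((mul_le_mul_of_nonneg_right ?_ (sqNorm_nonneg _)).trans
          (mul_le_mul_of_nonneg_left (ih (by omega) y) (sub_nonneg.2 hq)))
        have := mul_le_mul_of_nonneg_left (hδ _ h1) hκ0
        linarith
    rw [propagate_add]
    refine (sqNorm_propagate_le hA _ _ _).trans ((hwin N le_rfl _).trans ?_)
    exact mul_le_mul_of_nonneg_left (sqNorm_propagate_le hA _ _ _) (pow_nonneg (sub_nonneg.2 hq) _)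

end Contraction

/-! ### Discounted sum of squared stepsizes. -/

section NoiseSum

theorem sum_range_mul_block (f : ℕ → ℝ) (m L : ℕ) :
    ∑ r ∈ Finset.range (m * L), f r
      = ∑ j ∈ Finset.range m, ∑ i ∈ Finset.range L, f (j * L + i) := by
  induction m with
  | zero => simp
  | succ m ih => rw [Nat.succ_mul, Finset.sum_range_add, ih, Finset.sum_range_succ]

/-- Accumulated squared stepsizes, discounted by the number of contracting windows to come. -/
theorem sum_sq_mul_pow_le {L : ℕ} (hL : 0 < L) {Δ : ℕ → ℝ} (hΔ : Antitone Δ)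
    (hΔ0 : ∀ s, 0 ≤ Δ s) (hΔ1 : ∀ s, Δ s ≤ 1) {q : ℝ} (hq0 : 0 ≤ q) (hq1 : q < 1) (t h : ℕ)
    (hh : h ≤ (t - 1) / L) :
    ∑ r ∈ Finset.Ico 1 t, Δ r ^ 2 * q ^ ((t - 1) / L - (r + L - 1) / L)
      ≤ L * (h * q ^ ((t - 1) / L - h) + Δ (h * L + 1) ^ 2 * (1 + 1 / (1 - q))) := by
  set m := (t - 1) / L with hm
  have hmt : t - 1 ≤ (m + 1) * L := by
    have := Nat.lt_div_mul_add (a := t - 1) hL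
    rw [← hm] at this
    rw [Nat.succ_mul]; omega
  have h1 : ∑ r ∈ Finset.Ico 1 t, Δ r ^ 2 * q ^ (m - (r + L - 1) / L)
      ≤ ∑ r ∈ Finset.range ((m + 1) * L), Δ (r + 1) ^ 2 * q ^ (m - (r / L + 1)) := by
    rw [Finset.sum_Ico_eq_sum_range]
    refine (Finset.sum_le_sum_of_subset_of_nonneg (Finset.range_mono hmt) fun r _ _ =>
      mul_nonneg (sq_nonneg _) (pow_nonneg hq0 _)).trans_eq ?_
    refine Finset.sum_congr rfl fun r _ => ?_
    rw [show 1 + r + L - 1 = r + L by omega, Nat.add_div_right r hL, add_comm 1 r]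
  have h2 : ∀ j, ∑ i ∈ Finset.range L,
      Δ (j * L + i + 1) ^ 2 * q ^ (m - ((j * L + i) / L + 1))
        ≤ L * (Δ (j * L + 1) ^ 2 * q ^ (m - (j + 1))) := by
    intro j
    rw [← nsmul_eq_mul]
    refine (Finset.sum_le_card_nsmul _ _ _ fun i hi => ?_).trans_eq (by rw [Finset.card_range])
    rw [show (j * L + i) / L = j by
      rw [mul_comm, Nat.mul_add_div hL, Nat.div_eq_of_lt (Finset.mem_range.1 hi), add_zero]]
    refine mul_le_mul_of_nonneg_right ?_ (pow_nonneg hq0 _)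
    exact pow_le_pow_left₀ (hΔ0 _) (hΔ (by omega)) 2
  refine h1.trans ?_
  rw [sum_range_mul_block]
  refine (Finset.sum_le_sum fun j _ => h2 j).trans ?_
  rw [← Finset.mul_sum]
  refine mul_le_mul_of_nonneg_left ?_ (Nat.cast_nonneg _)
  -- Blocks before `h` are all discounted by at least `m - h` windows; for later ones the stepsize
  -- is frozen at the start of block `h` and the discounts are summed.
  rw [← Finset.sum_range_add_sum_Ico _ (show h ≤ m + 1 by omega)]
  refine add_le_add ?_ ?_
  · rw [← nsmul_eq_mul]
    refine (Finset.sum_le_card_nsmul _ _ _ fun j hj => ?_).trans_eq (by rw [Finset.card_range])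
    rw [Finset.mem_range] at hj
    calc Δ (j * L + 1) ^ 2 * q ^ (m - (j + 1)) ≤ 1 * q ^ (m - h) := by
          refine mul_le_mul (pow_le_one₀ (hΔ0 _) (hΔ1 _)) ?_ (pow_nonneg hq0 _) zero_le_one
          exact pow_le_pow_of_le_one hq0 hq1.le (by omega)
      _ = q ^ (m - h) := one_mul _
  · have hD : ∀ j ∈ Finset.Ico h (m + 1), Δ (j * L + 1) ^ 2 * q ^ (m - (j + 1))
        ≤ Δ (h * L + 1) ^ 2 * q ^ (m - (j + 1)) := fun j hj => by
      refine mul_le_mul_of_nonneg_right ?_ (pow_nonneg hq0 _)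
      refine pow_le_pow_left₀ (hΔ0 _) (hΔ ?_) 2
      exact Nat.succ_le_succ (Nat.mul_le_mul_right L (Finset.mem_Ico.1 hj).1)
    refine (Finset.sum_le_sum hD).trans ?_
    rw [← Finset.mul_sum]
    refine mul_le_mul_of_nonneg_left ?_ (sq_nonneg _)
    calc ∑ j ∈ Finset.Ico h (m + 1), q ^ (m - (j + 1))
        ≤ ∑ j ∈ Finset.range (m + 1), q ^ (m - (j + 1)) := by
          refine Finset.sum_le_sum_of_subset_of_nonneg (fun j hj => ?_) fun _ _ _ => pow_nonneg hq0 _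
          exact Finset.mem_range.2 (Finset.mem_Ico.1 hj).2
      -- The extra `1` is the incomplete last block `j = m`, which sees no full window.
      _ = ∑ j ∈ Finset.range m, q ^ j + 1 := by
          rw [Finset.sum_range_succ, Nat.sub_eq_zero_of_le (Nat.le_succ m), pow_zero,
            ← Finset.sum_range_reflect (fun j => q ^ j) m]
          congr 1
          exact Finset.sum_congr rfl fun j _ => by rw [add_comm j 1, Nat.sub_add_eq]
      _ ≤ 1 + 1 / (1 - q) := by
          rw [add_comm, one_div, ← tsum_geometric_of_lt_one hq0 hq1]
          gcongr
          exact (summable_geometric_of_lt_one hq0 hq1).sum_le_tsum _ fun _ _ => pow_nonneg hq0 _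

end NoiseSum

/-! ### Estimates for the polynomial stepsize and the time threshold. -/

section Stepsize

variable {ε : ℝ}

theorem stepsize_pos (t : ℕ) : 0 < stepsize ε t := by unfold stepsize; positivity

theorem stepsize_eq (t : ℕ) : stepsize ε t = ((t : ℝ) + 1) ^ (ε - 1) := by
  rw [stepsize, one_div, ← Real.rpow_neg (by positivity), neg_sub]

theorem stepsize_antitone (hε : ε < 1) : Antitone (stepsize ε) := by
  intro s t hst
  simp only [stepsize_eq]
  refine Real.rpow_le_rpow_of_nonpos (by positivity) ?_ (by linarith)
  have : (s : ℝ) ≤ t := by exact_mod_cast hst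
  linarith

theorem stepsize_le_one (hε : ε < 1) (t : ℕ) : stepsize ε t ≤ 1 := by
  rw [stepsize_eq]
  refine Real.rpow_le_one_of_one_le_of_nonpos ?_ (by linarith)
  have : (0 : ℝ) ≤ t := Nat.cast_nonneg t
  linarith

theorem rpow_le_stepsize (hε : ε < 1) {s t : ℕ} (h : s < t) : (t : ℝ) ^ (ε - 1) ≤ stepsize ε s := by
  rw [stepsize_eq]
  refine Real.rpow_le_rpow_of_nonpos (by positivity) ?_ (by linarith)
  exact_mod_cast h

/-- Discrete integral comparison: by Bernoulli's inequality for exponents in `(0, 1)`, each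
increment of `x ^ ε / ε` is at most the corresponding summand. -/
theorem le_sum_rpow (hε₀ : 0 < ε) (hε₁ : ε < 1) (m : ℕ) :
    (((m : ℝ) + 1) ^ ε - 1) / ε ≤ ∑ i ∈ Finset.range m, ((i : ℝ) + 1) ^ (ε - 1) := by
  induction m with
  | zero => simp
  | succ m ih =>
    rw [Finset.sum_range_succ]
    refine le_trans ?_ (add_le_add_left ih _)
    have hm : (0 : ℝ) < (m : ℝ) + 1 := by positivity
    have h1 : (1 + 1 / ((m : ℝ) + 1)) ^ ε ≤ 1 + ε * (1 / ((m : ℝ) + 1)) :=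
      rpow_one_add_le_one_add_mul_self
        ((by norm_num : (-1 : ℝ) ≤ 0).trans (by positivity)) hε₀.le hε₁.le
    have h2 : ((m : ℝ) + 1 + 1) ^ ε = ((m : ℝ) + 1) ^ ε * (1 + 1 / ((m : ℝ) + 1)) ^ ε := by
      rw [← Real.mul_rpow hm.le (by positivity)]
      congr 1; field_simp
    have h3 : ((m : ℝ) + 1) ^ (ε - 1) = ((m : ℝ) + 1) ^ ε * (1 / ((m : ℝ) + 1)) := by
      rw [Real.rpow_sub_one hm.ne']; ring
    push_cast
    rw [h2, h3, div_add' _ _ _ hε₀.ne', div_le_div_iff_of_pos_right hε₀]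
    nlinarith [mul_le_mul_of_nonneg_left h1 (Real.rpow_nonneg hm.le ε)]

/-- Lower bound for the total contraction exponent. -/
theorem le_sum_stepsize (hε₀ : 0 < ε) (hε₁ : ε < 1) {K : ℝ} (hK : 2 ≤ K) {L : ℕ} (hL0 : 0 < L)
    (hL : (L : ℝ) ≤ 2 * K - 1) {t : ℕ} (ht : 2 ≤ t / K) :
    ((t / K) ^ ε - 2) / (2 * K * ε)
      ≤ ∑ i ∈ Finset.range ((t - 1) / L), stepsize ε ((i + 1) * L) := by
  set m := (t - 1) / L with hm
  set u := (t : ℝ) / K with hu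
  have hK0 : 0 < K := by linarith
  -- The shift by one in the stepsize is absorbed by the `-1` in `L ≤ 2 * K - 1`: `(i + 1) L + 1 ≤ 2
  -- K (i + 1)`.
  have h1 : ∀ i : ℕ, (2 * K) ^ (ε - 1) * ((i : ℝ) + 1) ^ (ε - 1) ≤ stepsize ε ((i + 1) * L) := by
    intro i
    rw [stepsize_eq, ← Real.mul_rpow (by positivity) (by positivity)]
    refine Real.rpow_le_rpow_of_nonpos (by positivity) ?_ (by linarith)
    push_cast
    have : (0 : ℝ) ≤ i := Nat.cast_nonneg i
    nlinarith
  have h2 : u / 2 ≤ (m : ℝ) + 1 := by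
    have h3 : t ≤ (m + 1) * L := by
      have := Nat.lt_div_mul_add (a := t - 1) hL0
      rw [← hm] at this
      rw [Nat.succ_mul]; omega
    have h4 : (t : ℝ) ≤ (m + 1) * L := by exact_mod_cast h3
    rw [hu, div_div, div_le_iff₀ (by positivity)]
    refine h4.trans (mul_le_mul_of_nonneg_left (by linarith) (by positivity))
  calc (u ^ ε - 2) / (2 * K * ε) ≤ (2 * K) ^ (ε - 1) * ((((m : ℝ) + 1) ^ ε - 1) / ε) := by
        have h5 : (u / 2) ^ ε ≤ ((m : ℝ) + 1) ^ ε :=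
          Real.rpow_le_rpow (by positivity) h2 hε₀.le
        have h6 : (2 * K) ^ (ε - 1) = K ^ ε * 2 ^ ε / (2 * K) := by
          rw [Real.rpow_sub_one (by positivity), mul_comm 2 K, Real.mul_rpow hK0.le zero_le_two]
        have h7 : (u / 2) ^ ε * 2 ^ ε = u ^ ε := by
          rw [← Real.mul_rpow (by positivity) zero_le_two]; congr 1; ring
        have h8 : (1 : ℝ) ≤ K ^ ε := Real.one_le_rpow (by linarith) hε₀.le
        have h9 : (2 : ℝ) ^ ε ≤ 2 := by
          simpa using Real.rpow_le_rpow_of_exponent_le one_le_two hε₁.le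
        have h10 : (2 : ℝ) ^ ε ≤ u ^ ε := Real.rpow_le_rpow zero_le_two ht hε₀.le
        have h11 : (0 : ℝ) < 2 ^ ε := by positivity
        rw [h6, div_mul_div_comm]
        refine div_le_div_of_nonneg_right ?_ (by positivity)
        calc u ^ ε - 2 ≤ u ^ ε - 2 ^ ε := by linarith
          _ ≤ K ^ ε * (u ^ ε - 2 ^ ε) := le_mul_of_one_le_left (by linarith) h8
          _ = K ^ ε * 2 ^ ε * ((u / 2) ^ ε - 1) := by rw [← h7]; ring
          _ ≤ K ^ ε * 2 ^ ε * (((m : ℝ) + 1) ^ ε - 1) :=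
              mul_le_mul_of_nonneg_left (by linarith) (by positivity)
    _ ≤ (2 * K) ^ (ε - 1) * ∑ i ∈ Finset.range m, ((i : ℝ) + 1) ^ (ε - 1) :=
        mul_le_mul_of_nonneg_left (le_sum_rpow hε₀ hε₁ m) (by positivity)
    _ ≤ _ := by
        rw [Finset.mul_sum]
        exact Finset.sum_le_sum fun i _ => h1 i

/-- Merging the bases before estimating uses `K ≥ 2` to halve the constant: the worst case is `1 /
(0.49² · 2)`, just below `2.0825`. -/
theorem rpow_sq_mul_rpow_le (hε₀ : 0 < ε) (hε₁ : ε < 1) {K : ℝ} (hK : 2 ≤ K) :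
    ((49 / 100 : ℝ) ^ (ε - 1)) ^ 2 * K ^ (ε - 1) ≤ 2.0825 := by
  have hK0 : 0 < K := by linarith
  have : ((49 / 100 : ℝ) ^ (ε - 1)) ^ 2 * K ^ (ε - 1) = ((49 / 100) ^ 2 * K) ^ (ε - 1) := by
    rw [Real.mul_rpow (by positivity) hK0.le, ← Real.rpow_natCast ((49 / 100 : ℝ) ^ (ε - 1)),
      ← Real.rpow_natCast (49 / 100 : ℝ), ← Real.rpow_mul (by norm_num),
      ← Real.rpow_mul (by norm_num), mul_comm (ε - 1)]
  rw [this]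
  calc ((49 / 100) ^ 2 * K) ^ (ε - 1) ≤ ((49 / 100) ^ 2 * 2) ^ (ε - 1) :=
        Real.rpow_le_rpow_of_nonpos (by norm_num) (by linarith) (by linarith)
    _ ≤ ((49 / 100 : ℝ) ^ 2 * 2) ^ (-1 : ℝ) :=
        Real.rpow_le_rpow_of_exponent_ge (by norm_num) (by norm_num) (by linarith)
    _ ≤ 2.0825 := by rw [Real.rpow_neg_one]; norm_num

/-- The geometric series contributes `1 / (κ δ)` and the squared stepsize `δ²`; one factor `δ`
survives and supplies `u ^ (ε - 1)`. The constant is `2 · 2.0825 · 17/16 < 89/20`, with `17/16` from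
`1 + κ δ`. -/
theorem late_noise_le (hε₀ : 0 < ε) (hε₁ : ε < 1) {K L κ u δ D : ℝ} (hK : 2 ≤ K)
    (hL : L ≤ 2 * K) (hκ0 : 0 < κ) (hκ : κ ≤ 1 / 16) (hu : 0 < u) (hδ0 : 0 < δ) (hδ1 : δ ≤ 1)
    (hδ : δ = K ^ (ε - 1) * u ^ (ε - 1)) (hD0 : 0 ≤ D) (hD : D ≤ (49 / 100 : ℝ) ^ (ε - 1) * δ) :
    L * (D ^ 2 * (1 + 1 / (κ * δ))) ≤ 89 / 20 * (K / κ) * u ^ (ε - 1) := by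
  have hK0 : 0 < K := by linarith
  have hE : 0 < u ^ (ε - 1) := Real.rpow_pos_of_pos hu _
  have h2 := rpow_sq_mul_rpow_le hε₀ hε₁ hK
  set c := (49 / 100 : ℝ) ^ (ε - 1)
  set e := u ^ (ε - 1)
  set k := K ^ (ε - 1)
  have h3 : δ * (1 + 1 / (κ * δ)) ≤ 17 / 16 / κ := by
    have : δ * (1 + 1 / (κ * δ)) = (κ * δ + 1) / κ := by field_simp
    rw [this]
    refine div_le_div_of_nonneg_right ?_ hκ0.le
    have : κ * δ ≤ 1 / 16 * 1 := mul_le_mul hκ hδ1 hδ0.le (by norm_num)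
    linarith
  have h0 : 0 ≤ 1 + 1 / (κ * δ) := by positivity
  calc L * (D ^ 2 * (1 + 1 / (κ * δ))) ≤ (2 * K) * ((c * δ) ^ 2 * (1 + 1 / (κ * δ))) := by
        refine mul_le_mul hL ?_ (mul_nonneg (sq_nonneg _) h0) (by positivity)
        exact mul_le_mul_of_nonneg_right (pow_le_pow_left₀ hD0 hD 2) h0
    _ = (2 * K) * (c ^ 2 * (δ / e)) * (δ * (1 + 1 / (κ * δ))) * e := by field_simp
    _ = (2 * K) * (c ^ 2 * k) * (δ * (1 + 1 / (κ * δ))) * e := by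
        rw [show δ / e = k by rw [hδ]; field_simp]
    _ ≤ (2 * K) * 2.0825 * (17 / 16 / κ) * e := by
        refine mul_le_mul_of_nonneg_right (mul_le_mul (mul_le_mul_of_nonneg_left h2 ?_) h3 ?_ ?_)
          hE.le
        · positivity
        · exact mul_nonneg hδ0.le h0
        · positivity
    _ = (2 * 2.0825 * (17 / 16)) * (K / κ) * e := by ring
    _ ≤ 89 / 20 * (K / κ) * e := by
        refine mul_le_mul_of_nonneg_right (mul_le_mul_of_nonneg_right ?_ (by positivity)) hE.le
        norm_num

/-- The discount `(1 - κ δ) ^ N ≤ exp(-κ δ N)` is at most `u⁻²`, against at most `K u / 2` noise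
times with stepsize bounded by one. What is left, `K / (2 u)`, is below the target rate. -/
theorem early_noise_le (hε₀ : 0 < ε) (hε₁ : ε < 1) {K L κ u δ h : ℝ} {N : ℕ} (hK : 2 ≤ K)
    (hL0 : 0 < L) (hL : L ≤ 2 * K) (hκ0 : 0 < κ) (hu : 1 ≤ u) (hδ : δ = (K * u) ^ (ε - 1))
    (hκδ : κ * δ ≤ 1) (hlog : 9 * Real.log u ≤ κ * u ^ ε / K) (hh : h * L ≤ K * u / 2)
    (hN : 49 / 100 * ((K * u) / L) ≤ N) :
    h * L * (1 - κ * δ) ^ N ≤ K / 2 * u ^ (ε - 1) := by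
  have hK0 : 0 < K := by linarith
  have hu0 : 0 < u := by linarith
  have hδ0 : 0 < δ := hδ ▸ Real.rpow_pos_of_pos (mul_pos hK0 hu0) _
  have e1 : (1 - κ * δ) ^ N ≤ Real.exp (-(κ * δ * N)) := by
    have : 1 - κ * δ ≤ Real.exp (-(κ * δ)) := by
      have := Real.add_one_le_exp (-(κ * δ)); linarith
    refine (pow_le_pow_left₀ (sub_nonneg.2 hκδ) this _).trans_eq ?_
    rw [← Real.exp_nat_mul]
    congr 1; ring
  have e3 : 2 * Real.log u ≤ κ * δ * N := by
    have hlog0 : 0 ≤ Real.log u := Real.log_nonneg hu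
    have e4 : u ^ ε ≤ (K * u) ^ ε :=
      Real.rpow_le_rpow hu0.le (le_mul_of_one_le_left hu0.le (by linarith)) hε₀.le
    have e5 : δ * (K * u) = (K * u) ^ ε := by
      rw [hδ, Real.rpow_sub_one (mul_pos hK0 hu0).ne']; field_simp
    -- The factor `9` in the logarithmic hypothesis is dictated by `9 · 49/200 > 2`.
    calc 2 * Real.log u ≤ 49 / 200 * (9 * Real.log u) := by linarith
      _ ≤ 49 / 200 * (κ * u ^ ε / K) := by linarith
      _ ≤ 49 / 200 * (κ * (K * u) ^ ε / K) := by gcongr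
      _ = 49 / 100 * (κ * (K * u) ^ ε / (2 * K)) := by ring
      _ ≤ 49 / 100 * (κ * (K * u) ^ ε / L) := by gcongr
      _ = κ * δ * (49 / 100 * ((K * u) / L)) := by rw [← e5]; ring
      _ ≤ _ := mul_le_mul_of_nonneg_left hN (mul_pos hκ0 hδ0).le
  have e6 : Real.exp (-(κ * δ * N)) ≤ 1 / u * (1 / u) := by
    calc Real.exp (-(κ * δ * N)) ≤ Real.exp (-Real.log u + -Real.log u) :=
          Real.exp_le_exp.2 (by linarith)
      _ = _ := by rw [Real.exp_add, Real.exp_neg, Real.exp_log hu0, one_div]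
  have e7 : 1 / u ≤ u ^ (ε - 1) := by
    rw [one_div, ← Real.rpow_neg_one]
    exact Real.rpow_le_rpow_of_exponent_le hu (by linarith)
  calc h * L * (1 - κ * δ) ^ N ≤ (K * u / 2) * (1 / u * (1 / u)) :=
        mul_le_mul hh (e1.trans e6) (pow_nonneg (sub_nonneg.2 hκδ) _) (by positivity)
    _ = K / 2 * (1 / u) := by field_simp
    _ ≤ _ := mul_le_mul_of_nonneg_left e7 (by positivity)

/-- Upper bound for the accumulated noise. -/
theorem noise_bound (hε₀ : 0 < ε) (hε₁ : ε < 1) {K : ℝ} (hK : 2 ≤ K) {L : ℕ}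
    (hKL : K ≤ L) (hL : (L : ℝ) ≤ 2 * K) {κ : ℝ} (hκ0 : 0 < κ) (hκ : κ ≤ 1 / 16)
    {t : ℕ} (hu : 200 ≤ t / K) (hlog : 9 * Real.log (t / K) ≤ κ * (t / K) ^ ε / K) :
    ∑ r ∈ Finset.Ico 1 t, stepsize ε r ^ 2 *
        (1 - κ * (t : ℝ) ^ (ε - 1)) ^ ((t - 1) / L - (r + L - 1) / L)
      ≤ 5 * K / κ * (t / K) ^ (ε - 1) := by
  have hK0 : 0 < K := by linarith
  have hL0 : 0 < L := by
    have : (0 : ℝ) < L := by linarith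
    exact_mod_cast this
  set u := (t : ℝ) / K with hudef
  have htu : (t : ℝ) = K * u := by rw [hudef]; field_simp
  have hu0 : 0 < u := by linarith
  have ht400 : (400 : ℝ) ≤ t := by rw [htu]; nlinarith
  have ht0 : (0 : ℝ) < t := by linarith
  set δ := (t : ℝ) ^ (ε - 1) with hδ
  have hδ0 : 0 < δ := Real.rpow_pos_of_pos ht0 _
  have hδ1 : δ ≤ 1 := Real.rpow_le_one_of_one_le_of_nonpos (by linarith) (by linarith)
  have hκδ : 0 < κ * δ := mul_pos hκ0 hδ0
  have hκδ1 : κ * δ ≤ 1 := by nlinarith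
  set m := (t - 1) / L with hm
  have hmL : (t : ℝ) ≤ (m + 1) * L := by
    have h3 : t ≤ (m + 1) * L := by
      have := Nat.lt_div_mul_add (a := t - 1) hL0
      rw [← hm] at this
      rw [Nat.succ_mul]; omega
    exact_mod_cast h3
  have hmL' : (m : ℝ) * L ≤ t := by
    have : m * L ≤ t := (Nat.div_mul_le_self _ _).trans (Nat.sub_le _ _)
    exact_mod_cast this
  -- Cut at half of the windows. Since `u ≥ 200` and `L ≤ 2 K`, one window is at most a hundredth of
  -- `t`, so both `h * L` and `(m - h) * L` are at least `49/100 · t`.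
  set h := m / 2 with hh
  have hh1 : (m : ℝ) ≤ 2 * h + 1 := by
    have : m ≤ 2 * h + 1 := by omega
    exact_mod_cast this
  have hh2 : 2 * (h : ℝ) ≤ m := by
    have : 2 * h ≤ m := by omega
    exact_mod_cast this
  refine (sum_sq_mul_pow_le hL0 (stepsize_antitone hε₁) (fun s => (stepsize_pos s).le)
    (stepsize_le_one hε₁) (sub_nonneg.2 hκδ1) (by linarith) t h (Nat.div_le_self m 2)).trans ?_
  rw [← hm, sub_sub_cancel]
  have hLr : (0 : ℝ) < L := by exact_mod_cast hL0
  have hLt : (L : ℝ) ≤ t / 100 := by rw [htu]; nlinarith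
  have hE : 0 < u ^ (ε - 1) := Real.rpow_pos_of_pos hu0 _
  have hδu : δ = K ^ (ε - 1) * u ^ (ε - 1) := by
    rw [hδ, htu, Real.mul_rpow hK0.le hu0.le]
  have hmh : (m : ℝ) / 2 ≤ ((m - h : ℕ) : ℝ) := by
    rw [Nat.cast_sub (Nat.div_le_self m 2)]
    linarith
  have hhL : (h : ℝ) * L ≤ K * u / 2 := by
    have := mul_le_mul_of_nonneg_right hh2 hLr.le
    linarith
  have hmu : 49 / 50 * ((K * u) / L) ≤ (m : ℝ) := by
    rw [← mul_div_assoc, div_le_iff₀ hLr]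
    linarith
  have early : (L : ℝ) * (h * (1 - κ * δ) ^ (m - h)) ≤ K / 2 * u ^ (ε - 1) := by
    rw [← mul_assoc, mul_comm (L : ℝ)]
    exact early_noise_le hε₀ hε₁ hK hLr hL hκ0 (by linarith) (htu ▸ hδ) hκδ1 hlog hhL
      (by linarith)
  have hD : stepsize ε (h * L + 1) ≤ (49 / 100 : ℝ) ^ (ε - 1) * δ := by
    rw [stepsize_eq, hδ, ← Real.mul_rpow (by norm_num) ht0.le]
    refine Real.rpow_le_rpow_of_nonpos (by positivity) ?_ (by linarith)
    push_cast
    have : (t : ℝ) - 2 * L ≤ 2 * (h * L) := by nlinarith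
    linarith
  have late := late_noise_le hε₀ hε₁ hK hL hκ0 hκ hu0 hδ0 hδ1 hδu (stepsize_pos _).le hD
  rw [mul_add]
  refine (add_le_add early late).trans ?_
  have : K / 2 ≤ 1 / 32 * (K / κ) := by
    have : 16 * K ≤ K / κ := by
      rw [le_div_iff₀ hκ0]; nlinarith
    linarith
  have h0 : 0 < K / κ := by positivity
  calc K / 2 * u ^ (ε - 1) + 89 / 20 * (K / κ) * u ^ (ε - 1)
      = (K / 2 + 89 / 20 * (K / κ)) * u ^ (ε - 1) := by ring
    _ ≤ (5 * (K / κ)) * u ^ (ε - 1) := mul_le_mul_of_nonneg_right (by linarith) hE.le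
    _ = _ := by ring

/-- Bound `log` by its tangent at `y0 = 3 a log a`. As `y0 ≥ a` the tangent has slope at most `1 /
a`, and as `y0 ≤ a³` the inequality already holds at `y0`. -/
theorem mul_log_le_of_three_mul_le {a y : ℝ} (ha : 3 ≤ a) (hy : 3 * a * Real.log a ≤ y) :
    a * Real.log y ≤ y := by
  have hlog : 1 ≤ Real.log a := by
    rw [Real.le_log_iff_exp_le (by linarith)]
    linarith [Real.exp_one_lt_d9]
  set y0 := 3 * a * Real.log a with hy0
  have hy0a : a ≤ y0 := by rw [hy0]; nlinarith
  have hy0p : 0 < y0 := by linarith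
  have h1 : Real.log y ≤ Real.log y0 + (y / y0 - 1) := by
    have := Real.log_le_sub_one_of_pos (show 0 < y / y0 by exact div_pos (by linarith) hy0p)
    rw [Real.log_div (by linarith) hy0p.ne'] at this
    linarith
  have h2 : Real.log y0 ≤ 3 * Real.log a := by
    have h3 : y0 ≤ a ^ 3 := by
      have := Real.log_le_sub_one_of_pos (show 0 < a by linarith)
      rw [hy0]
      nlinarith [sq_nonneg (a - 2)]
    have := Real.log_le_log hy0p h3
    rwa [Real.log_pow] at this
  have h4 : a * (y / y0 - 1) ≤ y - y0 := by
    have : y / y0 - 1 = (y - y0) / y0 := by field_simp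
    rw [this, ← mul_div_assoc, div_le_iff₀ hy0p]
    nlinarith
  nlinarith [mul_le_mul_of_nonneg_left h1 (show 0 ≤ a by linarith)]

/-- The time threshold makes `u ^ ε` dominate `log u`. -/
theorem log_le_rpow_of_threshold (hε₀ : 0 < ε) (hε₁ : ε < 1) {a u : ℝ} (ha : 100 ≤ a)
    (hu : (3 * a * Real.log a) ^ (1 / ε) ≤ u / 2) :
    200 ≤ u ∧ a * ε / 2 * Real.log u ≤ u ^ ε := by
  have hlog : 1 ≤ Real.log a := by
    rw [Real.le_log_iff_exp_le (by linarith)]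
    linarith [Real.exp_one_lt_d9]
  have hy0 : 300 ≤ 3 * a * Real.log a := by nlinarith
  have h1 : 3 * a * Real.log a ≤ (3 * a * Real.log a) ^ (1 / ε) := by
    have := Real.rpow_le_rpow_of_exponent_le (show 1 ≤ 3 * a * Real.log a by linarith)
      (show 1 ≤ 1 / ε by rw [le_div_iff₀ hε₀]; linarith)
    rwa [Real.rpow_one] at this
  have hu600 : 600 ≤ u := by linarith
  refine ⟨by linarith, ?_⟩
  have h2 : 3 * a * Real.log a ≤ (u / 2) ^ ε := by
    have := Real.rpow_le_rpow (by positivity) hu hε₀.le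
    rwa [← Real.rpow_mul (by linarith), one_div, inv_mul_cancel₀ hε₀.ne', Real.rpow_one] at this
  have h3 := mul_log_le_of_three_mul_le (by linarith) h2
  rw [Real.log_rpow (by linarith)] at h3
  have h4 : Real.log u / 2 ≤ Real.log (u / 2) := by
    have : Real.log u ≤ Real.log ((u / 2) ^ 2) := Real.log_le_log (by linarith) (by nlinarith)
    rw [Real.log_pow] at this
    push_cast at this
    linarith
  calc a * ε / 2 * Real.log u = a * ε * (Real.log u / 2) := by ring
    _ ≤ a * ε * Real.log (u / 2) := mul_le_mul_of_nonneg_left h4 (by positivity)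
    _ = a * (ε * Real.log (u / 2)) := by ring
    _ ≤ (u / 2) ^ ε := h3
    _ ≤ u ^ ε := Real.rpow_le_rpow (by linarith) (by linarith) hε₀.le

end Stepsize

/-! ### Independence and conditional second moments. -/

section Independence

variable {Ω : Type*} [MeasurableSpace Ω] {P : Measure Ω} [IsProbabilityMeasure P]

/-- If `X` is independent of `(Y, W)` and `Y` is independent of `W`, then `(X, Y)` is independent
of `W`. -/
theorem indepFun_prodMk_left {α β γ : Type*} [MeasurableSpace α] [MeasurableSpace β]
    [MeasurableSpace γ] {X : Ω → α} {Y : Ω → β} {W : Ω → γ} (hX : Measurable X)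
    (hY : Measurable Y) (hW : Measurable W) (h : IndepFun X (fun ω => (Y ω, W ω)) P)
    (hYW : IndepFun Y W P) : IndepFun (fun ω => (X ω, Y ω)) W P := by
  have hXY : IndepFun X Y P := h.comp measurable_id measurable_fst
  have := Measure.isProbabilityMeasure_map (μ := P) hX.aemeasurable
  have := Measure.isProbabilityMeasure_map (μ := P) hY.aemeasurable
  have := Measure.isProbabilityMeasure_map (μ := P) hW.aemeasurable
  rw [indepFun_iff_map_prod_eq_prod_map_map (by fun_prop) (by fun_prop)] at h hYW hXY ⊢
  rw [hXY]
  -- The joint law is a triple product measure; reassociating it groups `X` with `Y`.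
  rw [hYW, ← Measure.prodAssoc_prod] at h
  have h2 := congrArg (Measure.map MeasurableEquiv.prodAssoc.symm) h
  rw [Measure.map_map (by fun_prop) (by fun_prop), Measure.map_map (by fun_prop) (by fun_prop),
    MeasurableEquiv.symm_comp_self, Measure.map_id] at h2
  exact h2

/-- Conditional second moment of the sum of a known and an independent centered variable. -/
theorem condExp_sq_add {Ω : Type*} {m mΩ : MeasurableSpace Ω} {P : Measure Ω}
    [IsProbabilityMeasure P] (hm : m ≤ mΩ) {f b : Ω → ℝ}
    (hfm : Measurable[m] f) (hf : MemLp f 2 P) (hb : MemLp b 2 P) (hbm : Measurable b)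
    (hind : Indep (MeasurableSpace.comap b inferInstance) m P) (hb0 : ∫ ω, b ω ∂P = 0) :
    P[fun ω => (f ω + b ω) ^ 2 | m] =ᵐ[P] fun ω => f ω ^ 2 + ∫ ω, b ω ^ 2 ∂P := by
  have hbcomap : Measurable[MeasurableSpace.comap b inferInstance] b := comap_measurable b
  have h1 : P[b | m] =ᵐ[P] fun _ => ∫ ω, b ω ∂P :=
    condExp_indep_eq hbm.comap_le hm hbcomap.stronglyMeasurable hind
  have h2 : P[fun ω => b ω ^ 2 | m] =ᵐ[P] fun _ => ∫ ω, b ω ^ 2 ∂P :=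
    condExp_indep_eq hbm.comap_le hm (hbcomap.pow_const 2).stronglyMeasurable hind
  have hfb : Integrable (f * b) P := hf.integrable_mul hb
  have h3 : P[f * b | m] =ᵐ[P] f * P[b | m] :=
    condExp_mul_of_stronglyMeasurable_left hfm.stronglyMeasurable hfb (hb.integrable (by norm_num))
  have h4 : P[fun ω => f ω ^ 2 | m] = fun ω => f ω ^ 2 :=
    condExp_of_stronglyMeasurable hm (hfm.pow_const 2).stronglyMeasurable hf.integrable_sq
  have hsum : (fun ω => (f ω + b ω) ^ 2)
      = (fun ω => f ω ^ 2) + ((2 : ℝ) • (f * b) + fun ω => b ω ^ 2) := by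
    funext ω
    simp only [Pi.add_apply, Pi.smul_apply, Pi.mul_apply, smul_eq_mul]
    ring
  rw [hsum]
  have h5 := condExp_add (m := m) hf.integrable_sq
    ((hfb.smul (2 : ℝ)).add hb.integrable_sq)
  have h6 := condExp_add (m := m) (hfb.smul (2 : ℝ)) hb.integrable_sq
  have h7 := condExp_smul (μ := P) (2 : ℝ) (f * b) m
  filter_upwards [h1, h2, h3, h5, h6, h7] with ω e1 e2 e3 e5 e6 e7
  rw [e5, Pi.add_apply, e6, Pi.add_apply, e7, Pi.smul_apply, e3, Pi.mul_apply, e1, e2, h4, hb0]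
  simp

end Independence

/-! ### Linear error dynamics and the exact conditional variance. -/

section Noise

variable {n l : ℕ} {Ω : Type*}

/-- Position in the family of all noises of the noise entering the update of a node at a given
time, either from its own measurement or from a neighbour. -/
def noiseIndex : ℕ × Fin n × Option (Fin n) → (Fin n × ℕ) ⊕ (Fin n × Fin n × ℕ)
  | (r, k, none) => Sum.inl (k, r)
  | (r, k, some j) => Sum.inr (k, j, r)

theorem noiseIndex_injective : Function.Injective (noiseIndex (n := n)) := by
  rintro ⟨r, k, _ | j⟩ ⟨r', k', _ | j'⟩ h <;> simp_all [noiseIndex]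

/-- Coefficient with which a noise enters the update. -/
def noiseCoeff (G : ℕ → SimpleGraph (Fin n)) (S : ℕ → Finset (Fin n)) :
    ℕ × Fin n × Option (Fin n) → ℝ
  | (r, k, none) => if k ∈ S r then 1 else 0
  | (r, k, some j) => weight (G r) k j

/-- One coordinate of a noise, weighted as in the update. -/
def noiseEntry (G : ℕ → SimpleGraph (Fin n)) (S : ℕ → Finset (Fin n))
    (wm : Fin n → ℕ → Ω → EuclideanSpace ℝ (Fin l))
    (wc : Fin n → Fin n → ℕ → Ω → EuclideanSpace ℝ (Fin l)) (a : Fin l)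
    (p : ℕ × Fin n × Option (Fin n)) (ω : Ω) : ℝ :=
  noiseCoeff G S p * noiseFamily wm wc (noiseIndex p) ω a

variable {Δ : ℕ → ℝ} {G : ℕ → SimpleGraph (Fin n)} {S : ℕ → Finset (Fin n)}
  {μ : EuclideanSpace ℝ (Fin l)} {wm : Fin n → ℕ → Ω → EuclideanSpace ℝ (Fin l)}
  {wc : Fin n → Fin n → ℕ → Ω → EuclideanSpace ℝ (Fin l)}
  {v₀ : Ω → Fin n → EuclideanSpace ℝ (Fin l)}

/-- The estimation error in one coordinate evolves linearly. -/
theorem estimate_succ_sub (t : ℕ) (ω : Ω) (a : Fin l) :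
    (fun i => estimate Δ G S μ wm wc v₀ (t + 1) ω i a - μ a)
      = step (Δ t) (G t) (S t) (fun i => estimate Δ G S μ wm wc v₀ t ω i a - μ a)
        + (Δ t / 4) • fun i => ∑ o, noiseEntry G S wm wc a (t, i, o) ω := by
  funext i
  set v := estimate Δ G S μ wm wc v₀ t ω with hv
  have h1 : estimate Δ G S μ wm wc v₀ (t + 1) ω i a
      = v i a + (if i ∈ S t then Δ t / 4 * ((μ a + wm i t ω a) - v i a) else 0)
        + Δ t / 4 * ∑ j, weight (G t) i j * (v j a - v i a + wc i j t ω a) := by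
    rw [sum_weight_mul]
    simp only [estimate, ← hv]
    split_ifs <;> simp [mul_add]
  rw [h1]
  simp only [Pi.add_apply, Pi.smul_apply, smul_eq_mul, step_apply, Fintype.sum_option, noiseEntry,
    noiseCoeff, noiseIndex, noiseFamily, Sum.elim_inl, Sum.elim_inr]
  have h2 : ∑ j, weight (G t) i j * (v j a - v i a + wc i j t ω a)
      = - ∑ j, weight (G t) i j * (v i a - μ a - (v j a - μ a))
        + ∑ j, weight (G t) i j * wc i j t ω a := by
    rw [← Finset.sum_neg_distrib, ← Finset.sum_add_distrib]
    exact Finset.sum_congr rfl fun j _ => by ring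
  rw [h2]
  split_ifs <;> ring

/-- Unrolled dynamics of the estimation error from time `1`. -/
theorem estimate_sub_eq (t : ℕ) (ω : Ω) (a : Fin l) :
    (fun i => estimate Δ G S μ wm wc v₀ (t + 1) ω i a - μ a)
      = propagate (fun s => step (Δ s) (G s) (S s)) 1 t
          (fun i => estimate Δ G S μ wm wc v₀ 1 ω i a - μ a)
        + ∑ r ∈ Finset.Ico 1 (t + 1),
            propagate (fun s => step (Δ s) (G s) (S s)) (r + 1) (t + 1 - (r + 1))
              ((Δ r / 4) • fun i => ∑ o, noiseEntry G S wm wc a (r, i, o) ω) := by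
  induction t with
  | zero => simp [propagate]
  | succ t ih =>
    rw [estimate_succ_sub, ih, map_add, map_sum,
      Finset.sum_Ico_succ_top (show 1 ≤ t + 1 by omega), add_assoc]
    congr 1
    · rw [propagate, LinearMap.comp_apply, add_comm 1 t]
    · congr 1
      · refine Finset.sum_congr rfl fun r hr => ?_
        rw [Finset.mem_Ico] at hr
        rw [show t + 1 + 1 - (r + 1) = (t + 1 - (r + 1)) + 1 by omega, propagate,
          LinearMap.comp_apply, show r + 1 + (t + 1 - (r + 1)) = t + 1 by omega]
      · rw [Nat.sub_self, propagate, LinearMap.id_apply]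

theorem linearMap_apply_eq_sum (A : (Fin n → ℝ) →ₗ[ℝ] (Fin n → ℝ)) (x : Fin n → ℝ) (i : Fin n) :
    A x i = ∑ k, A (Pi.single k 1) i * x k := by
  have h := A.pi_apply_eq_sum_univ x
  have h2 : ∀ k : Fin n, (fun j => if k = j then (1 : ℝ) else 0) = Pi.single k 1 := by
    intro k; funext j
    simp [Pi.single_apply, eq_comm]
  rw [h, Finset.sum_apply]
  exact Finset.sum_congr rfl fun k _ => by rw [h2, Pi.smul_apply, smul_eq_mul, mul_comm]

/-- Coefficient of a noise in the error of node `i` at time `t`. -/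
def impulseResponse (Δ : ℕ → ℝ) (G : ℕ → SimpleGraph (Fin n)) (S : ℕ → Finset (Fin n)) (t : ℕ)
    (i : Fin n) (p : ℕ × Fin n × Option (Fin n)) : ℝ :=
  Δ p.1 / 4 *
    propagate (fun s => step (Δ s) (G s) (S s)) (p.1 + 1) (t - (p.1 + 1)) (Pi.single p.2.1 1) i

theorem estimate_apply_sub_eq (t : ℕ) (ω : Ω) (a : Fin l) (i : Fin n) :
    estimate Δ G S μ wm wc v₀ (t + 1) ω i a - μ a
      = propagate (fun s => step (Δ s) (G s) (S s)) 1 t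
          (fun i => estimate Δ G S μ wm wc v₀ 1 ω i a - μ a) i
        + ∑ p ∈ Finset.Ico 1 (t + 1) ×ˢ Finset.univ,
            impulseResponse Δ G S (t + 1) i p * noiseEntry G S wm wc a p ω := by
  have h := congrFun (estimate_sub_eq (Δ := Δ) (G := G) (S := S) (μ := μ) (wm := wm) (wc := wc)
    (v₀ := v₀) t ω a) i
  refine h.trans ?_
  rw [Pi.add_apply, Finset.sum_apply, Finset.sum_product]
  congr 1
  refine Finset.sum_congr rfl fun r _ => ?_
  rw [map_smul, Pi.smul_apply, linearMap_apply_eq_sum, Fintype.sum_prod_type, smul_eq_mul,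
    Finset.mul_sum]
  refine Finset.sum_congr rfl fun k _ => ?_
  rw [Finset.mul_sum, Finset.mul_sum]
  exact Finset.sum_congr rfl fun o _ => by rw [impulseResponse]; ring

/-- The σ-algebra is arbitrary: later it is the one generated by `v₀` and the noises of time `0`,
which shows that it contains the information in `v(1)`. -/
theorem measurable_estimate_succ [MeasurableSpace Ω] {t : ℕ}
    (h : Measurable (estimate Δ G S μ wm wc v₀ t)) (hm : ∀ i, Measurable (wm i t))
    (hc : ∀ i j, Measurable (wc i j t)) : Measurable (estimate Δ G S μ wm wc v₀ (t + 1)) := by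
  classical
  refine measurable_pi_lambda _ fun i => ?_
  have hi : ∀ i, Measurable fun ω => estimate Δ G S μ wm wc v₀ t ω i := fun i =>
    (measurable_pi_apply i).comp h
  simp only [estimate]
  refine ((hi i).add ?_).add ?_
  · split_ifs
    · exact (((hm i).const_add μ).sub (hi i)).const_smul (Δ t / 4)
    · exact measurable_const
  · refine Measurable.const_smul (Finset.measurable_fun_sum _ fun j _ => ?_) (Δ t / 4)
    exact (((hi j).sub (hi i)).add (hc i j)).const_smul (1 / maxDeg (G t) i j)

variable [MeasurableSpace Ω] {P : Measure Ω} {σ σ' : ℝ}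

theorem NoiseModel.measurable_noiseFamily (h : NoiseModel P G S σ σ' wm wc v₀)
    (p : (Fin n × ℕ) ⊕ (Fin n × Fin n × ℕ)) : Measurable (noiseFamily wm wc p) := by
  rcases p with p | p
  · exact h.measurable_wm _ _
  · exact h.measurable_wc _ _ _

theorem NoiseModel.measurable_estimate (h : NoiseModel P G S σ σ' wm wc v₀) (t : ℕ) :
    Measurable (estimate Δ G S μ wm wc v₀ t) := by
  induction t with
  | zero => exact h.measurable_init
  | succ t ih =>
    exact measurable_estimate_succ ih (fun i => h.measurable_wm i t)
      fun i j => h.measurable_wc i j t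

theorem NoiseModel.measurable_noiseEntry (h : NoiseModel P G S σ σ' wm wc v₀) (a : Fin l)
    (p : ℕ × Fin n × Option (Fin n)) : Measurable (noiseEntry G S wm wc a p) := by
  have := h.measurable_noiseFamily (noiseIndex p)
  unfold noiseEntry
  fun_prop

/-- Moments of the weighted noise entries. -/
theorem NoiseModel.moments_noiseEntry (h : NoiseModel P G S σ σ' wm wc v₀) (a : Fin l)
    (p : ℕ × Fin n × Option (Fin n)) :
    MemLp (noiseEntry G S wm wc a p) 2 P ∧ ∫ ω, noiseEntry G S wm wc a p ω ∂P = 0 ∧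
      ProbabilityTheory.variance (noiseEntry G S wm wc a p) P
        = noiseCoeff G S p ^ 2 * (p.2.2.elim σ fun _ => σ') ^ 2 := by
  have key : ∀ (c s : ℝ) (w : Ω → EuclideanSpace ℝ (Fin l)),
      (c ≠ 0 → CenteredWithVariance P s w) →
      MemLp (fun ω => c * w ω a) 2 P ∧ ∫ ω, c * w ω a ∂P = 0 ∧
        ProbabilityTheory.variance (fun ω => c * w ω a) P = c ^ 2 * s ^ 2 := by
    intro c s w hw
    -- Noises that the protocol does not use have no prescribed moments, but their coefficient is
    -- zero.
    by_cases hc : c = 0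
    · subst hc
      refine ⟨by simp, by simp, ?_⟩
      rw [variance_of_integral_eq_zero (by simp only [zero_mul]; exact aemeasurable_const)
        (by simp)]
      simp
    · obtain ⟨h1, h2, h3⟩ := hw hc a
      refine ⟨h1.const_mul c, ?_, ?_⟩
      · rw [integral_const_mul, h2, mul_zero]
      · rw [variance_const_mul, h3]
  rcases p with ⟨r, k, _ | j⟩
  · refine key _ σ (wm k r) fun hc => h.moments_wm r k ?_
    by_contra hk
    exact hc (if_neg hk)
  · refine key _ σ' (wc k j r) fun hc => h.moments_wc r k j ?_
    by_contra hk
    exact hc (weight_eq_zero hk)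

theorem NoiseModel.indepFun_noiseEntry (h : NoiseModel P G S σ σ' wm wc v₀) (a : Fin l)
    {p q : ℕ × Fin n × Option (Fin n)} (hpq : p ≠ q) :
    IndepFun (noiseEntry G S wm wc a p) (noiseEntry G S wm wc a q) P := by
  have := h.indep_noise.indepFun (noiseIndex_injective.ne hpq)
  exact this.comp (φ := fun w => noiseCoeff G S p * w a) (ψ := fun w => noiseCoeff G S q * w a)
    (by fun_prop) (by fun_prop)

/-- Second moment of a linear combination of noise entries. -/
theorem NoiseModel.moments_sum_noiseEntry (h : NoiseModel P G S σ σ' wm wc v₀) (a : Fin l)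
    (J : Finset (ℕ × Fin n × Option (Fin n))) (c : ℕ × Fin n × Option (Fin n) → ℝ) :
    MemLp (fun ω => ∑ p ∈ J, c p * noiseEntry G S wm wc a p ω) 2 P ∧
      ∫ ω, ∑ p ∈ J, c p * noiseEntry G S wm wc a p ω ∂P = 0 ∧
      ∫ ω, (∑ p ∈ J, c p * noiseEntry G S wm wc a p ω) ^ 2 ∂P
        = ∑ p ∈ J, c p ^ 2 * (noiseCoeff G S p ^ 2 * (p.2.2.elim σ fun _ => σ') ^ 2) := by
  have := h.indep_noise.isProbabilityMeasure
  have hL : ∀ p, MemLp (fun ω => c p * noiseEntry G S wm wc a p ω) 2 P := fun p =>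
    (h.moments_noiseEntry a p).1.const_mul (c p)
  have h1 : MemLp (fun ω => ∑ p ∈ J, c p * noiseEntry G S wm wc a p ω) 2 P :=
    memLp_finsetSum J fun p _ => hL p
  have h2 : ∫ ω, ∑ p ∈ J, c p * noiseEntry G S wm wc a p ω ∂P = 0 := by
    rw [integral_finsetSum J fun p _ => (hL p).integrable (by norm_num)]
    refine Finset.sum_eq_zero fun p _ => ?_
    rw [integral_const_mul, (h.moments_noiseEntry a p).2.1, mul_zero]
  refine ⟨h1, h2, ?_⟩
  rw [← variance_of_integral_eq_zero h1.aemeasurable h2]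
  have h3 : (fun ω => ∑ p ∈ J, c p * noiseEntry G S wm wc a p ω)
      = ∑ p ∈ J, fun ω => c p * noiseEntry G S wm wc a p ω := by
    funext ω; rw [Finset.sum_apply]
  rw [h3, IndepFun.variance_sum (fun p _ => hL p)]
  · refine Finset.sum_congr rfl fun p _ => ?_
    rw [variance_const_mul, (h.moments_noiseEntry a p).2.2]
  · intro p _ q _ hpq
    exact (h.indepFun_noiseEntry a hpq).comp (measurable_const_mul (c p)) (measurable_const_mul (c q))

theorem NoiseModel.memLp_estimate (h : NoiseModel P G S σ σ' wm wc v₀) (t : ℕ) (i : Fin n)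
    (a : Fin l) : MemLp (fun ω => estimate Δ G S μ wm wc v₀ t ω i a - μ a) 2 P := by
  have := h.indep_noise.isProbabilityMeasure
  induction t generalizing i with
  | zero =>
    exact ((EuclideanSpace.proj a : EuclideanSpace ℝ (Fin l) →L[ℝ] ℝ).comp_memLp' (h.memLp_init i)).sub (memLp_const (μ a))
  | succ t ih =>
    have he : (fun ω => estimate Δ G S μ wm wc v₀ (t + 1) ω i a - μ a)
        = fun ω => (∑ k, step (Δ t) (G t) (S t) (Pi.single k 1) i
            * (estimate Δ G S μ wm wc v₀ t ω k a - μ a))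
          + Δ t / 4 * ∑ o, noiseEntry G S wm wc a (t, i, o) ω := by
      funext ω
      refine (congrFun (estimate_succ_sub t ω a) i).trans ?_
      rw [Pi.add_apply, linearMap_apply_eq_sum]
      rfl
    rw [he]
    refine (memLp_finsetSum _ fun k _ => (ih k).const_mul _).add ?_
    exact (memLp_finsetSum _ fun o _ => (h.moments_noiseEntry a _).1).const_mul _

theorem variance_eq_sum (v : Fin n → EuclideanSpace ℝ (Fin l)) :
    variance μ v = ∑ a, sqNorm fun i => v i a - μ a := by
  unfold variance sqNorm
  rw [Finset.sum_comm]
  exact Finset.sum_congr rfl fun i _ => by rw [EuclideanSpace.real_norm_sq_eq]; rfl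

theorem NoiseModel.integrable_variance (h : NoiseModel P G S σ σ' wm wc v₀) (t : ℕ) :
    Integrable (fun ω => variance μ (estimate Δ G S μ wm wc v₀ t ω)) P := by
  simp only [variance_eq_sum, sqNorm]
  exact integrable_finsetSum _ fun a _ => integrable_finsetSum _ fun i _ =>
    (h.memLp_estimate t i a).integrable_sq

/-- Linear combinations of later noises are independent of the estimates at time `1`. -/
theorem NoiseModel.indep_sum_noiseEntry (h : NoiseModel P G S σ σ' wm wc v₀) (a : Fin l) (t : ℕ)
    (c : ℕ × Fin n × Option (Fin n) → ℝ) :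
    Indep (MeasurableSpace.comap (fun ω => ∑ p ∈ Finset.Ico 1 t ×ˢ Finset.univ,
        c p * noiseEntry G S wm wc a p ω) inferInstance)
      (MeasurableSpace.comap (estimate Δ G S μ wm wc v₀ 1) inferInstance) P := by
  classical
  have := h.indep_noise.isProbabilityMeasure
  -- `J0` indexes the noises of time `0`, on which `v(1)` depends together with `v₀`; `J1` indexes
  -- those of times `1` to `t - 1`.
  set J0 : Finset ((Fin n × ℕ) ⊕ (Fin n × Fin n × ℕ)) :=
    ({0} ×ˢ Finset.univ : Finset (ℕ × Fin n × Option (Fin n))).image noiseIndex with hJ0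
  set J1 : Finset ((Fin n × ℕ) ⊕ (Fin n × Fin n × ℕ)) :=
    (Finset.Ico 1 t ×ˢ Finset.univ : Finset (ℕ × Fin n × Option (Fin n))).image noiseIndex with hJ1
  have hdisj : Disjoint J0 J1 := by
    refine (Finset.disjoint_image noiseIndex_injective).2 ?_
    rw [Finset.disjoint_left]
    rintro ⟨r, k⟩ h0 h1
    simp only [Finset.mem_product, Finset.mem_singleton, Finset.mem_Ico, Finset.mem_univ,
      and_true] at h0 h1
    omega
  set N0 : Ω → (p : J0) → EuclideanSpace ℝ (Fin l) := fun ω p => noiseFamily wm wc p ω with hN0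
  set N1 : Ω → (p : J1) → EuclideanSpace ℝ (Fin l) := fun ω p => noiseFamily wm wc p ω with hN1
  have hm0 : Measurable N0 := measurable_pi_lambda _ fun p => h.measurable_noiseFamily p
  have hm1 : Measurable N1 := measurable_pi_lambda _ fun p => h.measurable_noiseFamily p
  have h01 : IndepFun N0 N1 P :=
    h.indep_noise.indepFun_finset J0 J1 hdisj h.measurable_noiseFamily
  have hinit : IndepFun v₀ (fun ω => (N0 ω, N1 ω)) P :=
    h.indep_init.comp (φ := id) (ψ := fun (f : (Fin n × ℕ) ⊕ (Fin n × Fin n × ℕ) → EuclideanSpace ℝ (Fin l)) =>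
      ((fun p : J0 => f p.1), (fun p : J1 => f p.1))) measurable_id (by fun_prop)
  have hind := indepFun_prodMk_left h.measurable_init hm0 hm1 hinit h01
  have hle0 : MeasurableSpace.comap (estimate Δ G S μ wm wc v₀ 1) inferInstance
      ≤ MeasurableSpace.comap (fun ω => (v₀ ω, N0 ω)) inferInstance := by
    have hc : Measurable[MeasurableSpace.comap (fun ω => (v₀ ω, N0 ω)) inferInstance]
        (fun ω => (v₀ ω, N0 ω)) := comap_measurable _
    have hN : ∀ p ∈ J0, Measurable[MeasurableSpace.comap (fun ω => (v₀ ω, N0 ω)) inferInstance]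
        (noiseFamily wm wc p) := fun p hp =>
      (measurable_pi_apply (⟨p, hp⟩ : J0)).comp (measurable_snd.comp hc)
    refine Measurable.comap_le ?_
    refine @measurable_estimate_succ n l Ω Δ G S μ wm wc v₀
      (MeasurableSpace.comap (fun ω => (v₀ ω, N0 ω)) inferInstance) 0 (measurable_fst.comp hc)
      (fun i => hN (Sum.inl (i, 0)) ?_) (fun i j => hN (Sum.inr (i, j, 0)) ?_)
    · exact Finset.mem_image.2 ⟨(0, i, none), by simp, rfl⟩
    · exact Finset.mem_image.2 ⟨(0, i, some j), by simp, rfl⟩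
  have hle1 : MeasurableSpace.comap (fun ω => ∑ p ∈ Finset.Ico 1 t ×ˢ Finset.univ,
        c p * noiseEntry G S wm wc a p ω) inferInstance
      ≤ MeasurableSpace.comap N1 inferInstance := by
    have hc : Measurable[MeasurableSpace.comap N1 inferInstance] N1 := comap_measurable _
    refine Measurable.comap_le ?_
    refine Finset.measurable_fun_sum _ fun p hp => ?_
    have hN : Measurable[MeasurableSpace.comap N1 inferInstance]
        (noiseFamily wm wc (noiseIndex p)) :=
      (measurable_pi_apply (⟨noiseIndex p, Finset.mem_image_of_mem _ hp⟩ : J1)).comp hc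
    have hg : Measurable fun w : EuclideanSpace ℝ (Fin l) => c p * (noiseCoeff G S p * w a) := by
      fun_prop
    exact hg.comp hN
  exact indep_of_indep_of_le_left (indep_of_indep_of_le_right hind.symm hle0) hle1

/-- Mean contribution of the noises after time `0` to the variance at time `t`, per coordinate. -/
def noiseVariance (Δ : ℕ → ℝ) (G : ℕ → SimpleGraph (Fin n)) (S : ℕ → Finset (Fin n)) (σ σ' : ℝ)
    (t : ℕ) : ℝ :=
  ∑ i, ∑ p ∈ Finset.Ico 1 t ×ˢ Finset.univ,
    impulseResponse Δ G S t i p ^ 2 * (noiseCoeff G S p ^ 2 * (p.2.2.elim σ fun _ => σ') ^ 2)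

/-- The conditional expectation of the variance splits into the noiseless part and the noise. -/
theorem NoiseModel.condExp_variance (h : NoiseModel P G S σ σ' wm wc v₀) (t : ℕ) :
    P[fun ω => variance μ (estimate Δ G S μ wm wc v₀ (t + 1) ω) |
        MeasurableSpace.comap (estimate Δ G S μ wm wc v₀ 1) inferInstance] =ᵐ[P]
      fun ω => ∑ a, sqNorm (propagate (fun s => step (Δ s) (G s) (S s)) 1 t
          fun i => estimate Δ G S μ wm wc v₀ 1 ω i a - μ a)
        + l * noiseVariance Δ G S σ σ' (t + 1) := by
  have := h.indep_noise.isProbabilityMeasure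
  set v := estimate Δ G S μ wm wc v₀ with hv
  set J : Finset (ℕ × Fin n × Option (Fin n)) := Finset.Ico 1 (t + 1) ×ˢ Finset.univ with hJ
  set A := propagate (fun s => step (Δ s) (G s) (S s)) 1 t with hA
  have hterm : ∀ (a : Fin l) (i : Fin n),
      P[fun ω => (v (t + 1) ω i a - μ a) ^ 2 | MeasurableSpace.comap (v 1) inferInstance] =ᵐ[P]
        fun ω => A (fun i => v 1 ω i a - μ a) i ^ 2
          + ∑ p ∈ J, impulseResponse Δ G S (t + 1) i p ^ 2
              * (noiseCoeff G S p ^ 2 * (p.2.2.elim σ fun _ => σ') ^ 2) := by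
    intro a i
    obtain ⟨h1, h2, h3⟩ := h.moments_sum_noiseEntry a J (impulseResponse Δ G S (t + 1) i)
    have hfm : Measurable[MeasurableSpace.comap (v 1) inferInstance]
        fun ω => A (fun i => v 1 ω i a - μ a) i := by
      have hg : Measurable fun x : Fin n → EuclideanSpace ℝ (Fin l) =>
          A (fun i => x i a - μ a) i := by
        rw [funext fun x : Fin n → EuclideanSpace ℝ (Fin l) =>
          linearMap_apply_eq_sum A (fun i => x i a - μ a) i]
        fun_prop
      exact hg.comp (comap_measurable (v 1))
    have hf : MemLp (fun ω => A (fun i => v 1 ω i a - μ a) i) 2 P := by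
      rw [funext fun ω => linearMap_apply_eq_sum A (fun i => v 1 ω i a - μ a) i]
      exact memLp_finsetSum _ fun k _ => (h.memLp_estimate 1 k a).const_mul _
    have hb : Measurable fun ω => ∑ p ∈ J, impulseResponse Δ G S (t + 1) i p
        * noiseEntry G S wm wc a p ω :=
      Finset.measurable_fun_sum _ fun p _ => (h.measurable_noiseEntry a p).const_mul _
    have hc := condExp_sq_add (h.measurable_estimate 1).comap_le hfm hf h1 hb (h.indep_sum_noiseEntry a (t + 1) _) h2
    rw [h3] at hc
    simpa only [hv, estimate_apply_sub_eq t] using hc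
  have hsum : (fun ω => variance μ (v (t + 1) ω))
      = ∑ a : Fin l, ∑ i : Fin n, fun ω => (v (t + 1) ω i a - μ a) ^ 2 := by
    funext ω
    simp only [variance_eq_sum, sqNorm, Finset.sum_apply]
  rw [hsum]
  have hint : ∀ (a : Fin l) (i : Fin n), Integrable (fun ω => (v (t + 1) ω i a - μ a) ^ 2) P :=
    fun a i => (h.memLp_estimate (t + 1) i a).integrable_sq
  have h1 := condExp_finsetSum (s := Finset.univ) (f := fun a : Fin l =>
    ∑ i : Fin n, fun ω => (v (t + 1) ω i a - μ a) ^ 2)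
    (fun a _ => integrable_finsetSum' _ fun i _ => hint a i)
    (MeasurableSpace.comap (v 1) inferInstance)
  have h2 : ∀ a : Fin l, _ := fun a => condExp_finsetSum (s := Finset.univ)
    (f := fun i : Fin n => fun ω => (v (t + 1) ω i a - μ a) ^ 2) (fun i _ => hint a i)
    (MeasurableSpace.comap (v 1) inferInstance)
  filter_upwards [h1, ae_all_iff.2 h2, ae_all_iff.2 fun a => ae_all_iff.2 (hterm a)]
    with ω e1 e2 e3
  rw [e1, Finset.sum_apply]
  simp only [e2, Finset.sum_apply, e3, Finset.sum_add_distrib, sqNorm, noiseVariance]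
  simp [hJ]

/-- Weights lie in `[0, 1]` with row sums at most one, so their squares do too: averaging over
neighbours injects at most one unit of communication variance per node. -/
theorem sum_noiseCoeff_sq_le (r : ℕ) (k : Fin n) :
    ∑ o, noiseCoeff G S (r, k, o) ^ 2 * (o.elim σ fun _ => σ') ^ 2
      ≤ (if k ∈ S r then σ ^ 2 else 0) + σ' ^ 2 := by
  rw [Fintype.sum_option]
  simp only [noiseCoeff, Option.elim]
  refine add_le_add (by split_ifs <;> simp) ?_
  rw [← Finset.sum_mul]
  refine mul_le_of_le_one_left (sq_nonneg _) (le_trans ?_ (sum_weight_le_one (G r) k))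
  refine Finset.sum_le_sum fun j _ => ?_
  have h0 := weight_nonneg (G r) k j
  have h1 := weight_le_one (G r) k j
  nlinarith

/-- The noise contribution, bounded through operator norms of the noiseless dynamics. -/
theorem noiseVariance_le {t : ℕ} {ρ : ℕ → ℝ} {M : ℝ} (hρ0 : ∀ r, 0 ≤ ρ r)
    (hρ : ∀ r x, sqNorm (propagate (fun s => step (Δ s) (G s) (S s)) (r + 1) (t - (r + 1)) x)
      ≤ ρ r * sqNorm x)
    (hM : ∀ r, ((S r).card : ℝ) ≤ M) :
    noiseVariance Δ G S σ σ' t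
      ≤ (M * σ ^ 2 + n * σ' ^ 2) / 16 * ∑ r ∈ Finset.Ico 1 t, Δ r ^ 2 * ρ r := by
  unfold noiseVariance
  rw [Finset.sum_comm, Finset.sum_product, Finset.mul_sum]
  refine Finset.sum_le_sum fun r _ => ?_
  rw [Fintype.sum_prod_type]
  have h1 : ∀ k : Fin n, ∑ o : Option (Fin n), ∑ i, impulseResponse Δ G S t i (r, k, o) ^ 2
        * (noiseCoeff G S (r, k, o) ^ 2 * (o.elim σ fun _ => σ') ^ 2)
      ≤ (Δ r ^ 2 / 16 * ρ r) * ((if k ∈ S r then σ ^ 2 else 0) + σ' ^ 2) := by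
    intro k
    have h2 : ∀ o : Option (Fin n), ∑ i, impulseResponse Δ G S t i (r, k, o) ^ 2
        * (noiseCoeff G S (r, k, o) ^ 2 * (o.elim σ fun _ => σ') ^ 2)
        = (Δ r ^ 2 / 16 * sqNorm (propagate (fun s => step (Δ s) (G s) (S s)) (r + 1)
            (t - (r + 1)) (Pi.single k 1)))
          * (noiseCoeff G S (r, k, o) ^ 2 * (o.elim σ fun _ => σ') ^ 2) := by
      intro o
      rw [← Finset.sum_mul]
      congr 1
      unfold sqNorm impulseResponse
      rw [Finset.mul_sum]
      exact Finset.sum_congr rfl fun i _ => by ring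
    simp only [h2]
    rw [← Finset.mul_sum]
    have h3 : sqNorm (Pi.single k (1 : ℝ)) = 1 := by
      simp [sqNorm, Pi.single_apply, ite_pow]
    have h4 := hρ r (Pi.single k 1)
    rw [h3, mul_one] at h4
    refine mul_le_mul (mul_le_mul_of_nonneg_left h4 (by positivity)) (sum_noiseCoeff_sq_le r k)
      ?_ (mul_nonneg (by positivity) (hρ0 r))
    exact Finset.sum_nonneg fun o _ => by positivity
  refine (Finset.sum_le_sum fun k _ => h1 k).trans ?_
  rw [← Finset.mul_sum, Finset.sum_add_distrib, Finset.sum_ite_mem, Finset.univ_inter,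
    Finset.sum_const, Finset.sum_const, nsmul_eq_mul, nsmul_eq_mul, Finset.card_univ,
    Fintype.card_fin]
  have h5 : ((S r).card : ℝ) * σ ^ 2 ≤ M * σ ^ 2 :=
    mul_le_mul_of_nonneg_right (hM r) (sq_nonneg _)
  calc Δ r ^ 2 / 16 * ρ r * ((S r).card * σ ^ 2 + n * σ' ^ 2)
      ≤ Δ r ^ 2 / 16 * ρ r * (M * σ ^ 2 + n * σ' ^ 2) :=
        mul_le_mul_of_nonneg_left (by linarith) (mul_nonneg (by positivity) (hρ0 r))
    _ = _ := by ring

end Noise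

/-! ### Window contraction rates and the final constants. -/

section Bounds

variable {n l : ℕ}

/-- Consecutive measurement times differ by at least one and by less than `T`. The resulting `K ≥ 2`
is needed in the stepsize estimates. -/
theorem UniformMeasurement.two_le {T : ℕ} {S : ℕ → Finset (Fin n)} (h : UniformMeasurement T S) :
    2 ≤ T := by
  obtain ⟨τ, hτ, -, -, hgap⟩ := h
  have h1 := hτ (Nat.lt_succ_self 0)
  have h2 := hgap 0
  simp only [Nat.succ_eq_add_one, zero_add] at h1 h2
  omega

/-- Every `T` consecutive positive times contain a measurement time. -/
theorem UniformMeasurement.exists_nonempty {T : ℕ} {S : ℕ → Finset (Fin n)}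
    (h : UniformMeasurement T S) {s : ℕ} (hs : 1 ≤ s) : ∃ r < T, (S (s + r)).Nonempty := by
  obtain ⟨τ, hτ, hrange, h0, hgap⟩ := h
  have hS : ∀ k, (S (τ k)).Nonempty := fun k => by
    have : τ k ∈ Set.range τ := ⟨k, rfl⟩
    rwa [hrange] at this
  have hex : ∃ k, s ≤ τ k := ⟨s, hτ.id_le s⟩
  classical
  have hk := Nat.find_spec hex
  have hmin := fun m => Nat.find_min (H := hex) (m := m)
  set k := Nat.find hex
  refine ⟨τ k - s, ?_, by rw [Nat.add_sub_cancel' hk]; exact hS k⟩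
  rcases hk0 : k with _ | j
  -- Here `s ≤ τ 0 = 1`, hence `s = 1` is itself a measurement time.
  · rw [h0]
    have h1 := hτ (Nat.lt_succ_self 0)
    have h2 := hgap 0
    simp only [Nat.succ_eq_add_one, zero_add] at h1 h2
    omega
  · have h1 := hmin j (by omega)
    have h2 := hgap j
    omega

theorem bddAbove_card (S : ℕ → Finset (Fin n)) : BddAbove (Set.range fun t => (S t).card) :=
  ⟨n, by rintro _ ⟨t, rfl⟩; simpa using (S t).card_le_univ⟩

theorem card_le_maxMeasuring (S : ℕ → Finset (Fin n)) (t : ℕ) :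
    (S t).card ≤ maxMeasuring S := le_ciSup (bddAbove_card S) t

theorem maxDeg_le_dMax (G : ℕ → SimpleGraph (Fin n)) (t : ℕ) (i j : Fin n) :
    maxDeg (G t) i j ≤ dMax G := by
  classical
  have hb : BddAbove (Set.range fun p : ℕ × Fin n => (G p.1).degree p.2) := by
    refine ⟨n, ?_⟩
    rintro _ ⟨p, rfl⟩
    refine (SimpleGraph.degree_lt_card_verts _).le.trans ?_
    rw [Fintype.card_fin]
  have h : ∀ i, (G t).degree i ≤ dMax G := fun i => by
    refine le_trans (le_of_eq ?_) (le_ciSup hb (t, i))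
    congr!
  refine max_le ?_ ?_
  · refine Nat.cast_le.2 (le_trans (le_of_eq ?_) (h i)); congr!
  · refine Nat.cast_le.2 (le_trans (le_of_eq ?_) (h j)); congr!

/-- The union over a window of times that contains a block of `B`-connectivity is connected. -/
theorem BConnected.connected_window {B : ℕ} {G : ℕ → SimpleGraph (Fin n)} (hB : BConnected B G)
    {q : ℕ} (hq : 0 < q) (k : ℕ) :
    (⨆ s ∈ Finset.range (B * q), G (k * (B * q) + 1 + s)).Connected := by
  -- The block number `k * q` is the first of the `q` blocks making up window `k`.
  refine (hB.2 (k * q)).mono ?_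
  refine iSup₂_le fun s hs => ?_
  rw [Finset.mem_Icc] at hs
  have h1 : k * q * B = k * (B * q) := by ring
  have h2 : B ≤ B * q := Nat.le_mul_of_pos_right B hq
  rw [Nat.succ_mul, h1] at hs
  have h3 : s = k * (B * q) + 1 + (s - (k * (B * q) + 1)) := by omega
  rw [h3]
  exact le_iSup₂_of_le (s - (k * (B * q) + 1)) (Finset.mem_range.2 (by omega)) le_rfl

theorem propagate_window_le_sub {Δ : ℕ → ℝ} (hΔ : Antitone Δ) (hΔ0 : ∀ s, 0 ≤ Δ s)
    (hΔ1 : ∀ s, Δ s ≤ 1) (G : ℕ → SimpleGraph (Fin n)) (S : ℕ → Finset (Fin n)) (s e L : ℕ)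
    (he : s + L ≤ e + 1) (x : Fin n → ℝ) :
    sqNorm (propagate (fun s => step (Δ s) (G s) (S s)) s L x)
      ≤ sqNorm x - Δ e / 4 * ∑ r ∈ Finset.range L,
        energy (G (s + r)) (S (s + r)) (propagate (fun s => step (Δ s) (G s) (S s)) s r x) := by
  induction L with
  | zero => simp [propagate]
  | succ L ih =>
    have h1 := sqNorm_step_le (hΔ0 (s + L)) (hΔ1 (s + L)) (G (s + L)) (S (s + L))
      (propagate (fun s => step (Δ s) (G s) (S s)) s L x)
    have h2 : Δ e / 4 * energy (G (s + L)) (S (s + L))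
          (propagate (fun s => step (Δ s) (G s) (S s)) s L x)
        ≤ Δ (s + L) / 4 * energy (G (s + L)) (S (s + L))
          (propagate (fun s => step (Δ s) (G s) (S s)) s L x) := by
      refine mul_le_mul_of_nonneg_right ?_ (energy_nonneg _ _ _)
      have := hΔ (show s + L ≤ e by omega)
      linarith
    have h3 := ih (by omega)
    rw [Finset.sum_range_succ, mul_add]
    change sqNorm (step (Δ (s + L)) (G (s + L)) (S (s + L))
      (propagate (fun s => step (Δ s) (G s) (S s)) s L x)) ≤ _
    linarith

/-- Contraction over a window of jointly connected graphs containing a measurement. -/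
theorem window_contraction_of_connected {Δ : ℕ → ℝ} (hΔ : Antitone Δ) (hΔ0 : ∀ s, 0 ≤ Δ s)
    (hΔ1 : ∀ s, Δ s ≤ 1) (G : ℕ → SimpleGraph (Fin n)) (S : ℕ → Finset (Fin n)) {s e L : ℕ}
    (he : s + L ≤ e + 1) (hG : (⨆ r ∈ Finset.range L, G (s + r)).Connected)
    (hS : ∃ r < L, (S (s + r)).Nonempty) {d : ℝ} (hd1 : 1 ≤ d)
    (hd : ∀ t i j, maxDeg (G t) i j ≤ d) (hn : 0 < n) (x : Fin n → ℝ) :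
    sqNorm (propagate (fun s => step (Δ s) (G s) (S s)) s L x)
      ≤ (1 - 1 / (4 * n ^ 2 * d) * Δ e) * sqNorm x := by
  have h1 := propagate_window_le_sub hΔ hΔ0 hΔ1 G S s e L he x
  have h2 := sqNorm_le_sum_energy (L := L) (δ := fun r => Δ (s + r)) (fun r => hΔ0 _)
    (fun r => hΔ1 _) (G := fun r => G (s + r)) (S := fun r => S (s + r))
    (x := fun r => propagate (fun s => step (Δ s) (G s) (S s)) s r x) (fun r _ => rfl) hG hS hd1
    (fun r => hd (s + r))
  have hn' : (0 : ℝ) < n := by exact_mod_cast hn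
  have hD : 0 < (n : ℝ) ^ 2 * d := by positivity
  set E := ∑ r ∈ Finset.range L,
    energy (G (s + r)) (S (s + r)) (propagate (fun s => step (Δ s) (G s) (S s)) s r x)
  have h3 : sqNorm x / (n ^ 2 * d) ≤ E := by
    rw [div_le_iff₀ hD, mul_comm]
    exact h2
  calc _ ≤ sqNorm x - Δ e / 4 * E := h1
    _ ≤ sqNorm x - Δ e / 4 * (sqNorm x / (n ^ 2 * d)) := by
        have := mul_le_mul_of_nonneg_left h3 (div_nonneg (hΔ0 e) zero_le_four)
        linarith
    _ = _ := by field_simp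

/-- Contraction over a window containing a measurement, when every graph is connected. -/
theorem window_contraction_of_hitting (hn : 2 ≤ n) {Δ : ℕ → ℝ} (hΔ : Antitone Δ)
    (hΔ0 : ∀ s, 0 ≤ Δ s) (hΔ1 : ∀ s, Δ s ≤ 1) (G : ℕ → SimpleGraph (Fin n))
    (S : ℕ → Finset (Fin n)) {s e L : ℕ} (he : s + L ≤ e + 1) (hG : ∀ t, (G t).Connected)
    (hS : ∃ r < L, (S (s + r)).Nonempty) {H : ℝ} (hH0 : 0 < H)
    (hH : ∀ t i j, ∑' k, avoidProb (G t) i j k ≤ H) (x : Fin n → ℝ) :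
    sqNorm (propagate (fun s => step (Δ s) (G s) (S s)) s L x)
      ≤ (1 - 1 / (4 * H) * Δ e) * sqNorm x := by
  obtain ⟨r, hr, hSr⟩ := hS
  have hA : ∀ s x, sqNorm (step (Δ s) (G s) (S s) x) ≤ sqNorm x := fun s x =>
    sqNorm_step_le_sqNorm (hΔ0 s) (hΔ1 s) _ _ x
  -- Only the step at the measurement time `s + r` is used for contraction; the others merely do not
  -- expand.
  rw [show L = (r + 1) + (L - (r + 1)) by omega, propagate_add]
  refine (sqNorm_propagate_le hA _ _ _).trans ?_
  set y := propagate (fun s => step (Δ s) (G s) (S s)) s r x with hy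
  change sqNorm (step (Δ (s + r)) (G (s + r)) (S (s + r)) y) ≤ _
  have h1 := sqNorm_step_le (hΔ0 (s + r)) (hΔ1 (s + r)) (G (s + r)) (S (s + r)) y
  have h2 := sqNorm_le_hitting_mul_energy hn (hG (s + r)) hSr (hH (s + r)) y
  have h3 : sqNorm y / H ≤ energy (G (s + r)) (S (s + r)) y := by
    rw [div_le_iff₀ hH0, mul_comm]; exact h2
  have h4 : Δ e / 4 * (sqNorm y / H) ≤ Δ (s + r) / 4 * energy (G (s + r)) (S (s + r)) y := by
    have := hΔ (show s + r ≤ e by omega)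
    exact mul_le_mul (by linarith) h3 (div_nonneg (sqNorm_nonneg _) hH0.le)
      (div_nonneg (hΔ0 _) zero_le_four)
  have h5 : sqNorm y ≤ sqNorm x := sqNorm_propagate_le hA _ _ _
  have hn' : (2 : ℝ) ≤ n := by exact_mod_cast hn
  have i0 : Fin n := ⟨0, by omega⟩
  have hH4 : 4 * ((n : ℝ) - 1) ≤ H :=
    four_mul_le_of_tsum_avoidProb_le (hG 0) i0 hH0.le fun i => hH 0 i i0
  have h6 : 1 / (4 * H) * Δ e ≤ 1 := by
    have h7 : 1 / (4 * H) ≤ 1 := by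
      rw [div_le_one (by positivity)]; linarith
    exact mul_le_one₀ h7 (hΔ0 e) (hΔ1 e)
  calc _ ≤ sqNorm y - Δ e / 4 * (sqNorm y / H) := by linarith
    _ = (1 - 1 / (4 * H) * Δ e) * sqNorm y := by field_simp
    _ ≤ _ := mul_le_mul_of_nonneg_left h5 (sub_nonneg.2 h6)

/-- With `κ = 1 / (4 D)` the constant is `5 · 4 / 16 = 5/4`, rounded up to `2`. -/
theorem noise_term_le {l X Y K D U : ℝ} (hl : 0 ≤ l) (hK : 0 ≤ K) (hD : 0 < D) (hU : 0 ≤ U)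
    (hX : 0 ≤ X) (hXY : X ≤ Y) :
    l * (X / 16 * (5 * K / (1 / (4 * D)) * U)) ≤ 2 * (D * K * l * (Y * U)) := by
  have h1 : l * (X / 16 * (5 * K / (1 / (4 * D)) * U)) = 5 / 4 * (D * K * l * (X * U)) := by
    field_simp
    ring
  have h2 : D * K * l * (X * U) ≤ D * K * l * (Y * U) :=
    mul_le_mul_of_nonneg_left (mul_le_mul_of_nonneg_right hXY hU) (by positivity)
  have h3 : 0 ≤ D * K * l * (X * U) := by positivity
  linarith

theorem div_le_rate {w K D R ε : ℝ} (hw : 0 ≤ w) (hK : 0 < K) (hD : 0 < D) (hε : 0 < ε)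
    (hR : 8 * D * K * ε ≤ R) : w / R ≤ 1 / (4 * D) * (w / (2 * K * ε)) := by
  have h0 : 0 < 8 * D * K * ε := by positivity
  calc w / R ≤ w / (8 * D * K * ε) := div_le_div_of_nonneg_left hw h0 hR
    _ = _ := by field_simp; ring

theorem rate_identity {D K c x : ℝ} (hD : D ≠ 0) :
    1 / (4 * D) * (4 * D * c * x) / K = c / K * x := by
  field_simp

variable {Ω : Type*} [MeasurableSpace Ω] {P : Measure Ω} {ε σ σ' : ℝ}
  {G : ℕ → SimpleGraph (Fin n)} {S : ℕ → Finset (Fin n)}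
  {μ : EuclideanSpace ℝ (Fin l)} {wm : Fin n → ℕ → Ω → EuclideanSpace ℝ (Fin l)}
  {wc : Fin n → Fin n → ℕ → Ω → EuclideanSpace ℝ (Fin l)}
  {v₀ : Ω → Fin n → EuclideanSpace ℝ (Fin l)}

/-- Conditional variance bound from contraction over windows of length `L`. -/
theorem NoiseModel.condExp_variance_le (h : NoiseModel P G S σ σ' wm wc v₀)
    (hε₀ : 0 < ε) (hε₁ : ε < 1) {K : ℝ} (hK : 2 ≤ K) {L : ℕ} (hKL : K ≤ L)
    (hL : (L : ℝ) ≤ 2 * K - 1) {κ : ℝ} (hκ0 : 0 < κ) (hκ : κ ≤ 1 / 16)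
    (hw : ∀ k x, sqNorm (propagate (fun s => step (stepsize ε s) (G s) (S s)) (k * L + 1) L x)
      ≤ (1 - κ * stepsize ε ((k + 1) * L)) * sqNorm x)
    {t : ℕ} (hu : 200 ≤ t / K) (hlog : 9 * Real.log (t / K) ≤ κ * (t / K) ^ ε / K) :
    P[fun ω => variance μ (estimate (stepsize ε) G S μ wm wc v₀ t ω) |
        MeasurableSpace.comap (estimate (stepsize ε) G S μ wm wc v₀ 1) inferInstance] ≤ᵐ[P]
      fun ω => l * ((maxMeasuring S * σ ^ 2 + n * σ' ^ 2) / 16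
            * (5 * K / κ * ((t : ℝ) / K) ^ (ε - 1)))
        + Real.exp (-(κ * ((((t : ℝ) / K) ^ ε - 2) / (2 * K * ε))))
          * variance μ (estimate (stepsize ε) G S μ wm wc v₀ 1 ω) := by
  have hK0 : 0 < K := by linarith
  have hL0 : 0 < L := by
    have : (0 : ℝ) < L := by linarith
    exact_mod_cast this
  have ht400 : (400 : ℝ) ≤ t := by
    rw [le_div_iff₀ hK0] at hu; linarith
  have ht1 : 1 ≤ t := by
    have : (1 : ℝ) ≤ t := by linarith
    exact_mod_cast this
  have hA : ∀ s (x : Fin n → ℝ), sqNorm (step (stepsize ε s) (G s) (S s) x) ≤ sqNorm x :=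
    fun s x => sqNorm_step_le_sqNorm (stepsize_pos s).le (stepsize_le_one hε₁ s) _ _ x
  have hκΔ : ∀ s, κ * stepsize ε s ≤ 1 := fun s =>
    mul_le_one₀ (by linarith) (stepsize_pos s).le (stepsize_le_one hε₁ s)
  have hδ : ∀ s < t, (t : ℝ) ^ (ε - 1) ≤ stepsize ε s := fun s hs => rpow_le_stepsize hε₁ hs
  have hκδ : κ * (t : ℝ) ^ (ε - 1) ≤ 1 :=
    (mul_le_mul_of_nonneg_left (hδ 0 ht1) hκ0.le).trans (hκΔ 0)
  have hnoise : noiseVariance (stepsize ε) G S σ σ' t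
      ≤ (maxMeasuring S * σ ^ 2 + n * σ' ^ 2) / 16
            * (5 * K / κ * ((t : ℝ) / K) ^ (ε - 1)) := by
    refine (noiseVariance_le (ρ := fun r => (1 - κ * (t : ℝ) ^ (ε - 1)) ^
      ((t - 1) / L - (r + L - 1) / L)) (M := maxMeasuring S)
      (fun r => pow_nonneg (sub_nonneg.2 hκδ) _)
      (fun r x => sqNorm_propagate_le_pow hA hL0 hκ0.le hδ hκδ hw x)
      (fun r => by exact_mod_cast card_le_maxMeasuring S r)).trans ?_
    exact mul_le_mul_of_nonneg_left
      (noise_bound hε₀ hε₁ hK hKL (by linarith) hκ0 hκ hu hlog) (by positivity)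
  have hexp : Real.exp (-(κ * ∑ i ∈ Finset.range ((t - 1) / L), stepsize ε ((i + 1) * L)))
      ≤ Real.exp (-(κ * ((((t : ℝ) / K) ^ ε - 2) / (2 * K * ε)))) := by
    refine Real.exp_le_exp.2 (neg_le_neg (mul_le_mul_of_nonneg_left ?_ hκ0.le))
    exact le_sum_stepsize hε₀ hε₁ hK hL0 hL (by linarith)
  have hc := h.condExp_variance (Δ := stepsize ε) (μ := μ) (t - 1)
  rw [Nat.sub_add_cancel ht1] at hc
  refine hc.le.trans (Filter.Eventually.of_forall fun ω => ?_)
  dsimp only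
  rw [add_comm]
  refine add_le_add (mul_le_mul_of_nonneg_left hnoise (Nat.cast_nonneg l)) ?_
  rw [variance_eq_sum, Finset.mul_sum]
  refine Finset.sum_le_sum fun a _ => ?_
  exact (sqNorm_propagate_one_le hA hκΔ hw t _).trans
    (mul_le_mul_of_nonneg_right hexp (sqNorm_nonneg _))

/-- Conditional variance bound for connected graphs, through hitting times. -/
theorem NoiseModel.condExp_variance_le_hitting (h : NoiseModel P G S σ σ' wm wc v₀)
    (hn : 2 ≤ n) (hε₀ : 0 < ε) (hε₁ : ε < 1) {T : ℕ} (hT : UniformMeasurement T S)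
    (hG : ∀ t, (G t).Connected) {H : ℝ} (hH : H = (maxHittingTime G).toReal) {t : ℕ}
    (ht : 2 * T * (288 * T * H / ε * Real.log (96 * T * H / ε)) ^ (1 / ε) ≤ (t : ℝ)) :
    P[fun ω => variance μ (estimate (stepsize ε) G S μ wm wc v₀ t ω) |
        MeasurableSpace.comap (estimate (stepsize ε) G S μ wm wc v₀ 1) inferInstance] ≤ᵐ[P]
      fun ω => 15 * H * T * l * ((maxMeasuring S * σ ^ 2 + n * T * σ' ^ 2)
          / ((t : ℝ) / T - 1) ^ (1 - ε))
        + variance μ (estimate (stepsize ε) G S μ wm wc v₀ 1 ω)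
          * Real.exp (-((((t : ℝ) / T - 1) ^ ε - 2) / (24 * H * T * ε))) := by
  have hT2 : (2 : ℝ) ≤ T := by exact_mod_cast hT.two_le
  have hT0 : (0 : ℝ) < T := by linarith
  have hn' : (2 : ℝ) ≤ n := by exact_mod_cast hn
  have hHij : ∀ t i j, ∑' k, avoidProb (G t) i j k ≤ H := fun t i j =>
    hH ▸ tsum_avoidProb_le hG t i j
  have hH0 : 0 ≤ H := hH ▸ ENNReal.toReal_nonneg
  have hH4 : 4 ≤ H := by
    have i0 : Fin n := ⟨0, by omega⟩
    have := four_mul_le_of_tsum_avoidProb_le (hG 0) i0 hH0 fun i => hHij 0 i i0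
    linarith
  have hHp : 0 < H := by linarith
  have ha : 100 ≤ 96 * T * H / ε := by
    rw [le_div_iff₀ hε₀]
    have : 2 * 4 ≤ T * H := mul_le_mul hT2 hH4 (by norm_num) hT0.le
    nlinarith
  have hthr : (3 * (96 * T * H / ε) * Real.log (96 * T * H / ε)) ^ (1 / ε) ≤ (t : ℝ) / T / 2 := by
    rw [div_div, le_div_iff₀ (by positivity)]
    rw [show 3 * (96 * T * H / ε) = 288 * T * H / ε by ring]
    linarith
  obtain ⟨hu, hlog⟩ := log_le_rpow_of_threshold hε₀ hε₁ ha hthr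
  set u := (t : ℝ) / T with hudef
  have hlog0 : 0 ≤ Real.log u := Real.log_nonneg (by linarith)
  -- The threshold lemma with `a = 96 T H / ε` gives `48 T H log u ≤ u ^ ε`, that is `12 log u` on
  -- the left after dividing by `4 H T`.
  have hlog' : 9 * Real.log u ≤ 1 / (4 * H) * u ^ ε / T := by
    calc 9 * Real.log u ≤ 12 * Real.log u := by linarith
      _ = 1 / (4 * H) * (96 * T * H / ε * ε / 2 * Real.log u) / T := by
          rw [div_mul_cancel₀ _ hε₀.ne', show 96 * T * H / 2 = 4 * H * (12 * T) by ring,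
            rate_identity hHp.ne', mul_div_cancel_right₀ _ hT0.ne']
      _ ≤ _ := by gcongr
  have hanti := stepsize_antitone hε₁
  have hmain := h.condExp_variance_le (μ := μ) hε₀ hε₁ hT2 (L := T) le_rfl (by linarith)
    (κ := 1 / (4 * H)) (by positivity)
    (by rw [div_le_div_iff₀ (by positivity) (by norm_num)]; linarith)
    (fun k x => window_contraction_of_hitting hn hanti (fun s => (stepsize_pos s).le)
      (stepsize_le_one hε₁) G S (s := k * T + 1) (e := (k + 1) * T) (by rw [Nat.succ_mul]; omega)
      hG (hT.exists_nonempty (Nat.le_add_left 1 _)) hHp hHij x) hu hlog'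
  refine hmain.trans (Filter.Eventually.of_forall fun ω => ?_)
  dsimp only
  rw [← hudef]
  refine add_le_add ?_ ?_
  · have hu1 : u ^ (ε - 1) ≤ 1 / (u - 1) ^ (1 - ε) := by
      rw [one_div, ← Real.rpow_neg (by linarith), neg_sub]
      exact Real.rpow_le_rpow_of_nonpos (by linarith) (by linarith) (by linarith)
    have hnum : (maxMeasuring S * σ ^ 2 + n * σ' ^ 2 : ℝ)
        ≤ maxMeasuring S * σ ^ 2 + n * T * σ' ^ 2 := by
      have : (n : ℝ) * σ' ^ 2 ≤ n * T * σ' ^ 2 :=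
        mul_le_mul_of_nonneg_right (le_mul_of_one_le_right (by linarith) (by linarith))
          (sq_nonneg _)
      linarith
    have hx0 : (0 : ℝ) ≤ maxMeasuring S * σ ^ 2 + n * T * σ' ^ 2 := by positivity
    have hy0 : 0 ≤ 1 / (u - 1) ^ (1 - ε) :=
      one_div_nonneg.2 (Real.rpow_nonneg (by linarith) _)
    have hx1 : (0 : ℝ) ≤ maxMeasuring S * σ ^ 2 + n * σ' ^ 2 := by positivity
    have hu0 : 0 ≤ u ^ (ε - 1) := Real.rpow_nonneg (by linarith) _
    refine (noise_term_le (Nat.cast_nonneg l) hT0.le hHp hu0 hx1 hnum).trans ?_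
    calc 2 * (H * T * l * ((maxMeasuring S * σ ^ 2 + n * T * σ' ^ 2) * u ^ (ε - 1)))
        ≤ 15 * (H * T * l * ((maxMeasuring S * σ ^ 2 + n * T * σ' ^ 2)
          * (1 / (u - 1) ^ (1 - ε)))) := by
          refine mul_le_mul (by norm_num) ?_ (by positivity) (by norm_num)
          exact mul_le_mul_of_nonneg_left (mul_le_mul_of_nonneg_left hu1 hx0) (by positivity)
      _ = _ := by ring
  · rw [mul_comm]
    refine mul_le_mul_of_nonneg_left (Real.exp_le_exp.2 (neg_le_neg ?_))
      (Finset.sum_nonneg fun _ _ => sq_nonneg _)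
    have h1 : (u - 1) ^ ε ≤ u ^ ε := Real.rpow_le_rpow (by linarith) (by linarith) hε₀.le
    -- Enlarging the denominator of the rate weakens the bound only when the numerator `u ^ ε - 2`
    -- is nonnegative.
    have h2 : 2 ≤ u ^ ε := by
      refine le_trans ?_ hlog
      have h3 : 1 ≤ Real.log u := by
        rw [Real.le_log_iff_exp_le (by linarith)]
        linarith [Real.exp_one_lt_d9]
      have h4 : 2 ≤ 96 * T * H / ε * ε / 2 := by
        rw [div_mul_cancel₀ _ hε₀.ne']
        nlinarith
      nlinarith
    refine le_trans ?_ (div_le_rate (R := 24 * H * T * ε) (by linarith) hT0 hHp hε₀ ?_)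
    · exact div_le_div_of_nonneg_right (by linarith) (by positivity)
    · have : 0 < H * T * ε := by positivity
      linarith

/-- Conditional variance bound for jointly connected graphs. -/
theorem NoiseModel.condExp_variance_le_BConnected (h : NoiseModel P G S σ σ' wm wc v₀)
    (hn : 2 ≤ n) (hε₀ : 0 < ε) (hε₁ : ε < 1) {T : ℕ} (hT : UniformMeasurement T S)
    {B : ℕ} (hB : BConnected B G) {K : ℝ} (hK : K = max (T : ℝ) (B : ℝ)) {t : ℕ}
    (ht : 2 * K * (384 * n ^ 2 * dMax G * (1 + K) / ε *
          Real.log (128 * n ^ 2 * dMax G * (1 + K) / ε)) ^ (1 / ε) ≤ (t : ℝ)) :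
    P[fun ω => variance μ (estimate (stepsize ε) G S μ wm wc v₀ t ω) |
        MeasurableSpace.comap (estimate (stepsize ε) G S μ wm wc v₀ 1) inferInstance] ≤ᵐ[P]
      fun ω => 2 * n ^ 2 * dMax G * K * l *
              ((maxMeasuring S * σ ^ 2 + 2 * n * (1 + K) * σ' ^ 2) / ((t : ℝ) / K) ^ (1 - ε))
        + variance μ (estimate (stepsize ε) G S μ wm wc v₀ 1 ω)
          * Real.exp (-((((t : ℝ) / K) ^ ε - 2) / (32 * n ^ 2 * dMax G * (1 + K) * ε))) := by
  have hT2 : (2 : ℝ) ≤ T := by exact_mod_cast hT.two_le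
  have hK2 : 2 ≤ K := hK ▸ hT2.trans (le_max_left _ _)
  have hTK : (T : ℝ) ≤ K := hK ▸ le_max_left _ _
  have hBK : (B : ℝ) ≤ K := hK ▸ le_max_right _ _
  have hK0 : 0 < K := by linarith
  have hn' : (2 : ℝ) ≤ n := by exact_mod_cast hn
  have hB0 := hB.1
  -- This is `⌈T / B⌉`, so `L` is the least multiple of `B` that is at least `T`: a window contains
  -- a whole block and a measurement, and `L ≤ T + B - 1 ≤ 2 K - 1`.
  set q := (T - 1) / B + 1 with hq
  have hq0 : 0 < q := Nat.succ_pos _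
  set L := B * q with hL
  have hTL : T ≤ L := by
    have h1 := Nat.lt_div_mul_add (a := T - 1) hB0
    have h2 : L = (T - 1) / B * B + B := by rw [hL, hq]; ring
    have h3 := hT.two_le
    omega
  have hBL : B ≤ L := Nat.le_mul_of_pos_right B hq0
  have hLTB : L + 1 ≤ T + B := by
    have h1 := Nat.div_mul_le_self (T - 1) B
    have h2 : L = (T - 1) / B * B + B := by rw [hL, hq]; ring
    have h3 := hT.two_le
    omega
  have hKL : K ≤ L := hK ▸ max_le (by exact_mod_cast hTL) (by exact_mod_cast hBL)
  have hLK : (L : ℝ) ≤ 2 * K - 1 := by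
    have : (L : ℝ) + 1 ≤ T + B := by exact_mod_cast hLTB
    linarith
  have hd := maxDeg_le_dMax G
  set d : ℝ := (dMax G : ℝ) with hddef
  -- Since `n ≥ 2`, joint connectivity forces an edge leaving node `0` at some time, so the maximal
  -- degree is positive.
  have hd1 : 1 ≤ d := by
    obtain ⟨r, -, i, -, j, -, hadj⟩ := exists_adj_of_connected_iSup (hB.connected_window hq0 0)
      {(⟨0, by omega⟩ : Fin n)} (a := (⟨0, by omega⟩ : Fin n)) (b := (⟨1, by omega⟩ : Fin n)) rfl (by simp)
    exact (one_le_maxDeg hadj).trans (hd _ i j)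
  have hD : 4 ≤ (n : ℝ) ^ 2 * d := by nlinarith [mul_le_mul hn' hn' zero_le_two (by linarith)]
  have hD0 : 0 < (n : ℝ) ^ 2 * d := by linarith
  have ha : 100 ≤ 128 * n ^ 2 * d * (1 + K) / ε := by
    rw [le_div_iff₀ hε₀]
    have : 4 * 3 ≤ (n : ℝ) ^ 2 * d * (1 + K) :=
      mul_le_mul hD (by linarith) (by norm_num) hD0.le
    nlinarith
  have hthr : (3 * (128 * n ^ 2 * d * (1 + K) / ε) * Real.log (128 * n ^ 2 * d * (1 + K) / ε))
      ^ (1 / ε) ≤ (t : ℝ) / K / 2 := by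
    rw [div_div, le_div_iff₀ (by positivity),
      show 3 * (128 * n ^ 2 * d * (1 + K) / ε) = 384 * n ^ 2 * d * (1 + K) / ε by ring]
    linarith
  obtain ⟨hu, hlog⟩ := log_le_rpow_of_threshold hε₀ hε₁ ha hthr
  set u := (t : ℝ) / K with hudef
  have hlog1 : 1 ≤ Real.log u := by
    rw [Real.le_log_iff_exp_le (by linarith)]
    linarith [Real.exp_one_lt_d9]
  set D := (n : ℝ) ^ 2 * d with hDdef
  have hlog2 : 64 * D * (1 + K) * Real.log u ≤ u ^ ε := by
    refine le_trans (le_of_eq ?_) hlog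
    rw [div_mul_cancel₀ _ hε₀.ne', hDdef]
    ring
  have hκeq : 1 / (4 * n ^ 2 * d) = 1 / (4 * D) := by rw [hDdef]; ring_nf
  have hlog' : 9 * Real.log u ≤ 1 / (4 * D) * u ^ ε / K := by
    calc 9 * Real.log u ≤ 16 * (1 + K) / K * Real.log u := by
          refine mul_le_mul_of_nonneg_right ?_ (by linarith)
          rw [le_div_iff₀ hK0]; linarith
      _ = 1 / (4 * D) * (64 * D * (1 + K) * Real.log u) / K := by
          rw [show 64 * D * (1 + K) = 4 * D * (16 * (1 + K)) by ring, rate_identity hD0.ne']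
      _ ≤ _ := by gcongr
  have hanti := stepsize_antitone hε₁
  have hmain := h.condExp_variance_le (μ := μ) hε₀ hε₁ hK2 hKL hLK
    (κ := 1 / (4 * D)) (by positivity)
    (by rw [div_le_div_iff₀ (by positivity) (by norm_num)]; linarith)
    (fun k x => by
      obtain ⟨r, hr, hS⟩ := hT.exists_nonempty (Nat.le_add_left 1 (k * L))
      rw [← hκeq]
      exact window_contraction_of_connected hanti (fun s => (stepsize_pos s).le)
        (stepsize_le_one hε₁) G S (s := k * L + 1) (e := (k + 1) * L)
        (by rw [Nat.succ_mul]; omega) (hB.connected_window hq0 k)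
        ⟨r, hr.trans_le hTL, hS⟩ hd1 hd (by omega) x) hu hlog'
  refine hmain.trans (Filter.Eventually.of_forall fun ω => ?_)
  dsimp only
  rw [← hudef]
  refine add_le_add ?_ ?_
  · have hu1 : u ^ (ε - 1) = 1 / u ^ (1 - ε) := by
      rw [one_div, ← Real.rpow_neg (by linarith), neg_sub]
    have hnum : (maxMeasuring S * σ ^ 2 + n * σ' ^ 2 : ℝ)
        ≤ maxMeasuring S * σ ^ 2 + 2 * n * (1 + K) * σ' ^ 2 := by
      have : (n : ℝ) * σ' ^ 2 ≤ 2 * n * (1 + K) * σ' ^ 2 :=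
        mul_le_mul_of_nonneg_right (by nlinarith) (sq_nonneg _)
      linarith
    have hy0 : 0 ≤ 1 / u ^ (1 - ε) :=
      one_div_nonneg.2 (Real.rpow_nonneg (by linarith) _)
    rw [hu1]
    have hx1 : (0 : ℝ) ≤ maxMeasuring S * σ ^ 2 + n * σ' ^ 2 := by positivity
    refine (noise_term_le (Nat.cast_nonneg l) hK0.le hD0 hy0 hx1 hnum).trans (le_of_eq ?_)
    rw [hDdef]
    ring
  · rw [mul_comm]
    refine mul_le_mul_of_nonneg_left (Real.exp_le_exp.2 (neg_le_neg ?_))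
      (Finset.sum_nonneg fun _ _ => sq_nonneg _)
    have h2 : 2 ≤ u ^ ε := by
      refine le_trans ?_ hlog2
      have h4 : 2 ≤ 64 * D * (1 + K) := by nlinarith
      nlinarith
    refine div_le_rate (by linarith) hK0 hD0 hε₀ ?_
    have h3 : 0 < D * K * ε := by positivity
    have h4 : 0 < D * ε := by positivity
    rw [show 32 * (n : ℝ) ^ 2 * d * (1 + K) * ε = 32 * (D * ε) + 32 * (D * K * ε) by
      rw [hDdef]; ring]
    linarith

end Bounds

end

end CoopLearning

theorem theorem1 {n l : ℕ} (hn : 2 ≤ n) {Ω : Type*} [MeasurableSpace Ω]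
    (P : Measure Ω) [IsProbabilityMeasure P]
    (ε : ℝ) (hε₀ : 0 < ε) (hε₁ : ε < 1)
    (G : ℕ → SimpleGraph (Fin n)) (S : ℕ → Finset (Fin n))
    (T : ℕ) (hT : CoopLearning.UniformMeasurement T S)
    (μ : EuclideanSpace ℝ (Fin l)) (σ σ' : ℝ)
    (wm : Fin n → ℕ → Ω → EuclideanSpace ℝ (Fin l))
    (wc : Fin n → Fin n → ℕ → Ω → EuclideanSpace ℝ (Fin l))
    (v₀ : Ω → Fin n → EuclideanSpace ℝ (Fin l))
    (hnoise : CoopLearning.NoiseModel P G S σ σ' wm wc v₀)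
    (v : ℕ → Ω → Fin n → EuclideanSpace ℝ (Fin l))
    (hv : v = CoopLearning.estimate (CoopLearning.stepsize ε) G S μ wm wc v₀)
    (Z : ℕ → Ω → ℝ) (hZ : Z = fun t ω => CoopLearning.variance μ (v t ω))
    (M : ℝ) (hM : M = CoopLearning.maxMeasuring S)
    (d : ℝ) (hd : d = CoopLearning.dMax G) :
    (∀ t, Integrable (Z t) P) ∧
    ((∀ t, (G t).Connected) →
      CoopLearning.maxHittingTime G ≠ ⊤ ∧
      ∀ H : ℝ, H = (CoopLearning.maxHittingTime G).toReal →
      ∀ t : ℕ,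
        2 * T * (288 * T * H / ε * Real.log (96 * T * H / ε)) ^ (1 / ε) ≤ (t : ℝ) →
        P[Z t | MeasurableSpace.comap (v 1) inferInstance] ≤ᵐ[P] fun ω =>
          15 * H * T * l * ((M * σ ^ 2 + n * T * σ' ^ 2) / ((t : ℝ) / T - 1) ^ (1 - ε))
            + Z 1 ω * Real.exp (-((((t : ℝ) / T - 1) ^ ε - 2) / (24 * H * T * ε)))) ∧
    (∀ B : ℕ, CoopLearning.BConnected B G →
      ∀ K : ℝ, K = max (T : ℝ) (B : ℝ) →
      ∀ t : ℕ,
        2 * K * (384 * n ^ 2 * d * (1 + K) / ε *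
          Real.log (128 * n ^ 2 * d * (1 + K) / ε)) ^ (1 / ε) ≤ (t : ℝ) →
        P[Z t | MeasurableSpace.comap (v 1) inferInstance] ≤ᵐ[P] fun ω =>
          2 * n ^ 2 * d * K * l *
              ((M * σ ^ 2 + 2 * n * (1 + K) * σ' ^ 2) / ((t : ℝ) / K) ^ (1 - ε))
            + Z 1 ω * Real.exp (-((((t : ℝ) / K) ^ ε - 2) /
                (32 * n ^ 2 * d * (1 + K) * ε)))) := by
  subst hv hZ hM hd
  refine ⟨fun t => hnoise.integrable_variance t, fun hG => ⟨CoopLearning.maxHittingTime_ne_top hG,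
    fun H hH t ht => ?_⟩, fun B hB K hK t ht => ?_⟩
  · exact hnoise.condExp_variance_le_hitting hn hε₀ hε₁ hT hG hH ht
  · exact hnoise.condExp_variance_le_BConnected hn hε₀ hε₁ hT hB hK ht
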